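/- Let $\Lambda$ be a measure on $[0,\infty)$, finite on bounded sets, with $\Lambda(1):=\Lambda[0,1]>0$, and let $0<T_1<T_2<\cdots$ be the (finitely or infinitely many) points of a non-homogeneous Poisson process $N$ on $[0,\infty)$ with mean measure $\Lambda$, i.e. $N(t)=\#\{j:T_j\le t\}$ has $N(0)=0$, independent increments, and $N(t)-N(s)$ is Poisson distributed with mean $\Lambda(s,t]$ for $0\le s\le t$. Let $\nu$ be a measure on $(0,\infty)\times\mathbb R$ with $\nu((0,t]\times\{0\})=0$, $\nu(\{t\}\times\mathbb R)=0$ and $\int_{(0,t]\times\mathbb R}(|v|\wedge 1)\,\nu(d(u,v))<\infty$ for all $t>0$. Let $L_1,L_2,\dots$ be iid additive processes (independent increments, stochastically continuous, a.s. càdlàg paths), with $L_j(t)=0$ for $t\le 0$ a.s. and $$E[e^{ixL_j(t)}]=\exp\Big\{\int_{(0,t]\times\mathbb R}(e^{ixv}-1)\,\nu(d(u,v))\Big\},\qquad t\ge 0,\ x\in\mathbb R,$$ such that $(T_j)$ and $(L_j)$ are independent. Put $$M(t)=\sum_{j=1}^{N(1)}L_j(t-T_j)\quad(t\ge 1),\qquad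 M(t,t+s]=M(t+s)-M(t).$$ Let $(V_j)$ be an iid sequence with common distribution $\Lambda(dx)/\Lambda(1)$ on $[0,1]$, such that $(V_j)$, $(L_j)$ and $N$ are mutually independent. Then for all $t\ge 1$, $s>0$, $x\in\mathbb R$ and every Borel set $A\subset\mathbb R$ with $P(M(t)\in A)>0$, the probability $P\big(\sum_{j=1}^{N(1)}L_j(t-V_j)\in A\big)$ is positive, the random variable inside the expectation in the numerator below is integrable, and $$E\big[e^{ixM(t,t+s]}\,\big|\,M(t)\in A\big]=\frac{E\Big[\exp\Big\{\sum_{j=1}^{N(1)}\int_{(t-V_j,\,t+s-V_j]\times\mathbb R}(e^{ixv}-1)\,\nu(d(u,v))\Big\}\;P\Big(\sum_{j=1}^{N(1)}L_j(t-V_j)\in A\,\Big|\,N(1),(V_j)\Big)\Big]}{P\Big(\sum_{j=1}^{N(1)}L_j(t-V_j)\in A\Big)}.$$ -/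

import Mathlib

open MeasureTheory ProbabilityTheory Filter Topology Set
open scoped ENNReal NNReal

noncomputable section

namespace PoissonCluster

/-- A path on the real line is càdlàg: right-continuous with (finite) left limits. -/
def IsCadlag (f : ℝ → ℝ) : Prop :=
  ∀ t, ContinuousWithinAt f (Ici t) t ∧ ∃ l : ℝ, Tendsto f (𝓝[<] t) (𝓝 l)

/-- An additive process, extended by `0` to negative times: it starts at `0`, has independent (not
necessarily stationary) increments, is stochastically continuous, and has càdlàg paths a.s.
Because of `zero`, increments over negative times vanish, so that the conditions over `ℝ` are the
usual ones over `[0, ∞)`. -/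
structure IsAdditiveProcess {Ω : Type*} [MeasurableSpace Ω] (P : Measure Ω)
    (X : ℝ → Ω → ℝ) : Prop where
  measurable : ∀ t, Measurable (X t)
  zero : ∀ᵐ ω ∂P, ∀ t ≤ 0, X t ω = 0
  indep : HasIndepIncrements X P
  stochCont : ∀ t, TendstoInMeasure P X (𝓝 t) (X t)
  cadlag : ∀ᵐ ω ∂P, IsCadlag (fun t => X t ω)

/-- The conditions on the intensity measure `ν` of the jumps; only the restriction of `ν` to
`(0, ∞) × ℝ` (time × jump size) is relevant. -/
structure IsJumpIntensity (ν : Measure (ℝ × ℝ)) : Prop where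
  no_zero_jump : ∀ t : ℝ, ν (Ioc 0 t ×ˢ {0}) = 0
  no_fixed_jump : ∀ t : ℝ, 0 < t → ν ({t} ×ˢ univ) = 0
  integrable : ∀ t : ℝ, 0 ≤ t →
    ∫⁻ p in Ioc 0 t ×ˢ univ, ENNReal.ofReal (min |p.2| 1) ∂ν < ∞

/-- `∫_{(a,b] × ℝ} (e^{ixv} - 1) ν(d(u,v))`. -/
def jumpExponent (ν : Measure (ℝ × ℝ)) (x a b : ℝ) : ℂ :=
  ∫ p in Ioc a b ×ˢ univ, (Complex.exp (Complex.I * x * p.2) - 1) ∂ν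

/-- An additive process of jump type: `E[e^{ixX(t)}] = exp ∫_{(0,t] × ℝ} (e^{ixv} - 1) ν(d(u,v))`. -/
structure IsJumpAdditiveProcess {Ω : Type*} [MeasurableSpace Ω] (P : Measure Ω)
    (ν : Measure (ℝ × ℝ)) (X : ℝ → Ω → ℝ) : Prop extends IsAdditiveProcess P X where
  charFun_eq : ∀ t : ℝ, 0 ≤ t → ∀ x : ℝ,
    ∫ ω, Complex.exp (Complex.I * x * X t ω) ∂P = Complex.exp (jumpExponent ν x 0 t)

/-- `N(t)`, the number of points `T_j` in `[0, t]`. Points are listed from index `0`; the value `∞`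
means that the point does not exist (there are fewer points). -/
def count {Ω : Type*} (T : ℕ → Ω → ℝ≥0∞) (t : ℝ) (ω : Ω) : ℕ :=
  {j : ℕ | T j ω ≤ ENNReal.ofReal t}.ncard

/-- `0 < T_0 < T_1 < ⋯` are the points of a (non-homogeneous) Poisson process on `[0, ∞)` with mean
measure `Λ`: a.s. finitely many points in bounded sets, independent increments, and Poisson
distributed increments with mean `Λ (s, t]`. Since `N` is a.s. nondecreasing, the subtractions in
`ℕ` are genuine. Only the restriction of `Λ` to `[0, ∞)` is relevant. -/
structure IsPoissonPoints {Ω : Type*} [MeasurableSpace Ω] (P : Measure Ω)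
    (Λ : Measure ℝ) (T : ℕ → Ω → ℝ≥0∞) : Prop where
  measurable : ∀ j, Measurable (T j)
  pos : ∀ᵐ ω ∂P, 0 < T 0 ω
  mono : ∀ᵐ ω ∂P, ∀ j, T j ω ≤ T (j + 1) ω
  strict : ∀ᵐ ω ∂P, ∀ j, T j ω ≠ ∞ → T j ω < T (j + 1) ω
  finite : ∀ᵐ ω ∂P, ∀ t : ℝ, {j : ℕ | T j ω ≤ ENNReal.ofReal t}.Finite
  mean_zero : Λ {0} = 0
  mean_finite : ∀ t : ℝ, Λ (Icc 0 t) < ∞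
  indep : HasIndepIncrements (count T) P
  law : ∀ s t : ℝ, 0 ≤ s → s ≤ t →
    P.map (fun ω => count T t ω - count T s ω) = poissonMeasure (Λ (Ioc s t)).toNNReal

/-- The cluster model: Poisson points `T` with mean measure `Λ`, iid jump-type additive cluster
processes `L_j` with jump intensity `ν`, and `(T_j)`, `(L_j)` independent of each other. -/
structure IsClusterModel {Ω : Type*} [MeasurableSpace Ω] (P : Measure Ω)
    (Λ : Measure ℝ) (ν : Measure (ℝ × ℝ)) (T : ℕ → Ω → ℝ≥0∞) (L : ℕ → ℝ → Ω → ℝ) : Prop where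
  points : IsPoissonPoints P Λ T
  intensity : IsJumpIntensity ν
  cluster : ∀ j, IsJumpAdditiveProcess P ν (L j)
  cluster_indep : iIndepFun (fun j ω => (fun t => L j t ω : ℝ → ℝ)) P
  cluster_ident : ∀ j, IdentDistrib (fun ω => (fun t => L j t ω : ℝ → ℝ))
    (fun ω => (fun t => L 0 t ω : ℝ → ℝ)) P P
  indep : IndepFun (fun ω j => T j ω) (fun ω j t => L j t ω) P

/-- `M(t) = ∑_{j = 1}^{N(1)} L_j(t - T_j)`. -/
def clusterSum {Ω : Type*} (T : ℕ → Ω → ℝ≥0∞) (L : ℕ → ℝ → Ω → ℝ) (t : ℝ) (ω : Ω) : ℝ :=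
  ∑ j ∈ Finset.range (count T 1 ω), L j (t - (T j ω).toReal) ω

/-- `∑_{j = 1}^{N(1)} L_j(t - V_j)`. -/
def shiftedSum {Ω : Type*} (T : ℕ → Ω → ℝ≥0∞) (L : ℕ → ℝ → Ω → ℝ) (V : ℕ → Ω → ℝ)
    (t : ℝ) (ω : Ω) : ℝ :=
  ∑ j ∈ Finset.range (count T 1 ω), L j (t - V j ω) ω

/-- The σ-algebra generated by `N(1)` and the sequence `(V_j)`. -/
abbrev sigmaNV {Ω : Type*} (T : ℕ → Ω → ℝ≥0∞) (V : ℕ → Ω → ℝ) : MeasurableSpace Ω :=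
  MeasurableSpace.comap (fun ω => (count T 1 ω, fun j => V j ω)) inferInstance

/-- The random variable
`exp {∑_{j ≤ N(1)} ∫_{(t - V_j, t + s - V_j] × ℝ} (e^{ixv} - 1) ν(d(u,v))}`
`  * P(∑_{j ≤ N(1)} L_j(t - V_j) ∈ A | N(1), (V_j))`. -/
def numeratorVar {Ω : Type*} [MeasurableSpace Ω] (P : Measure Ω) (ν : Measure (ℝ × ℝ))
    (T : ℕ → Ω → ℝ≥0∞) (L : ℕ → ℝ → Ω → ℝ) (V : ℕ → Ω → ℝ)
    (t s x : ℝ) (A : Set ℝ) (ω : Ω) : ℂ :=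
  Complex.exp (∑ j ∈ Finset.range (count T 1 ω),
      jumpExponent ν x (t - V j ω) (t + s - V j ω))
    * ((P⟦{ω' | shiftedSum T L V t ω' ∈ A} | sigmaNV T V⟧) ω : ℝ)

end PoissonCluster

end

/-! The theorem replaces the ordered, dependent points `T j` by iid marks `V j`. Two facts make this
possible.

Order statistics property (`map_points_eq_map_sort`): on `N(1) = n` the points in `[0,1]` have the
law of `n` sorted marks. Over any partition of `(0,1]`, the cell counts of the points and those of
the first `N(1)` marks have the same characteristic function, that of independent Poisson variables
(`charFun_countIncr`, `charFun_markIncr`). Counts determine ordered points, because the `k`-th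
smallest point is at most `u` exactly when more than `k` points are (counting from `k = 0`).

Symmetry (`integral_pathFunctional_perm`): once the points are frozen and the paths integrated out,
`e^{ixM(t,t+s]} 1{M(t) ∈ A}` has a mean that is symmetric in the points, so sorting is invisible.
Indeed past and future increments are independent, so the mean is `exp(∑ jumpExponent)` times `P(∑
L_j(t - τ_j) ∈ A)`, and the law of the latter sum depends on the times only through a symmetric sum
of exponents (`map_sum_perm`).

Together they give `integral_points_eq_integral_marks`: points may be exchanged for marks in the
expectation over everything. Taking `x = 0`, `s = 0` there identifies the denominators. The frozen
mean, evaluated at `(N(1), V)`, is a.s. the variable in the numerator, since the conditional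
probability in it is itself a frozen mean (`numeratorVar_ae_eq`). -/

namespace PoissonCluster

variable {Ω : Type*} [MeasurableSpace Ω] {P : Measure Ω}

/-! ### The counting process -/

lemma measurable_count {T : ℕ → Ω → ℝ≥0∞} (hT : ∀ j, Measurable (T j)) (t : ℝ) :
    Measurable (count T t) := by
  have h : count T t = fun ω =>
      ⌊(∑' j, (T j ⁻¹' Iic (ENNReal.ofReal t)).indicator (1 : Ω → ℝ≥0∞) ω).toReal⌋₊ := by
    ext ω
    have : (∑' j, (T j ⁻¹' Iic (ENNReal.ofReal t)).indicator (1 : Ω → ℝ≥0∞) ω)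
        = (({j : ℕ | T j ω ≤ ENNReal.ofReal t}.encard : ℕ∞) : ℝ≥0∞) := by
      rw [← ENNReal.tsum_set_one, tsum_subtype {j : ℕ | T j ω ≤ ENNReal.ofReal t} (fun _ => 1)]
      rfl
    rw [this, count, Set.ncard]
    -- If infinitely many points qualify, both sides are `0`: `ncard` of an infinite set on one
    -- side, `toReal` of `∞` on the other.
    cases h : {j : ℕ | T j ω ≤ ENNReal.ofReal t}.encard <;> simp
  rw [h]
  refine Nat.measurable_floor.comp (Measurable.ennreal_toReal (Measurable.tsum fun j => ?_))
  exact measurable_one.indicator (hT j measurableSet_Iic)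

lemma lt_ncard_iff_mem_of_isLowerSet {S : Set ℕ} (hS : IsLowerSet S) (hf : S.Finite) (j : ℕ) :
    j < S.ncard ↔ j ∈ S := by
  obtain ⟨n, rfl⟩ : ∃ n, S = Iio n := by
    classical
    have hex : ∃ n, n ∉ S := hf.exists_notMem
    refine ⟨Nat.find hex, Set.ext fun i => ⟨fun hi => ?_, fun hi => ?_⟩⟩
    · by_contra hni
      exact Nat.find_spec hex (hS (not_lt.1 hni) hi)
    · by_contra hni
      exact Nat.find_min hex hi hni
  rw [← Finset.coe_Iio, Set.ncard_coe_finset]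
  simp

/-- Links counts to points. As points are listed from index `0`, the inequality on the left is
strict. -/
lemma IsPoissonPoints.ae_lt_count_iff {Λ : Measure ℝ} {T : ℕ → Ω → ℝ≥0∞}
    (h : IsPoissonPoints P Λ T) :
    ∀ᵐ ω ∂P, ∀ (t : ℝ) (j : ℕ), j < count T t ω ↔ T j ω ≤ ENNReal.ofReal t := by
  filter_upwards [h.mono, h.finite] with ω hm hf t j
  refine lt_ncard_iff_mem_of_isLowerSet (fun a b hba ha => ?_) (hf t) j
  exact (monotone_nat_of_le_succ hm hba).trans ha

lemma IsPoissonPoints.ae_count_zero {Λ : Measure ℝ} {T : ℕ → Ω → ℝ≥0∞}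
    (h : IsPoissonPoints P Λ T) : ∀ᵐ ω ∂P, count T 0 ω = 0 := by
  filter_upwards [h.ae_lt_count_iff, h.pos] with ω hc hp
  by_contra h0
  have := (hc 0 0).1 (Nat.pos_of_ne_zero h0)
  simp at this
  exact hp.ne' this

lemma IsPoissonPoints.ae_monotone_count {Λ : Measure ℝ} {T : ℕ → Ω → ℝ≥0∞}
    (h : IsPoissonPoints P Λ T) : ∀ᵐ ω ∂P, Monotone (fun t => count T t ω) := by
  filter_upwards [h.ae_lt_count_iff] with ω hc a b hab
  refine le_of_forall_lt fun j hj => (hc b j).2 (((hc a j).1 hj).trans ?_)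
  exact ENNReal.ofReal_le_ofReal hab

/-! ### Generating functional of a mixed binomial process -/

lemma integral_pow_poissonMeasure (r : ℝ≥0) (z : ℂ) :
    ∫ n, z ^ n ∂(poissonMeasure r) = Complex.exp (r * (z - 1)) := by
  rw [integral_poissonMeasure]
  have h := NormedSpace.expSeries_div_hasSum_exp ((r : ℂ) * z)
  rw [← Complex.exp_eq_exp_ℂ] at h
  have h2 := h.mul_left (Complex.exp (-r))
  rw [← Complex.exp_add] at h2
  rw [show (r : ℂ) * (z - 1) = -r + r * z by ring, ← h2.tsum_eq]
  refine tsum_congr fun n => ?_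
  rw [Complex.real_smul, mul_pow]
  push_cast
  ring

lemma integral_eq_of_forall_setIntegral_fiber_eq {E : Type*} [NormedAddCommGroup E]
    [NormedSpace ℝ E] {N : Ω → ℕ} (hN : Measurable N) {f g : Ω → E} (hf : Integrable f P)
    (hg : Integrable g P) (h : ∀ n, ∫ ω in N ⁻¹' {n}, f ω ∂P = ∫ ω in N ⁻¹' {n}, g ω ∂P) :
    ∫ ω, f ω ∂P = ∫ ω, g ω ∂P := by
  have hU : ⋃ n, N ⁻¹' {n} = univ := by ext ω; simp
  have hd : Pairwise (Function.onFun Disjoint fun n => N ⁻¹' {n}) := fun a b hab =>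
    Disjoint.preimage _ (by simpa using hab)
  have hm : ∀ n, MeasurableSet (N ⁻¹' {n}) := fun n => hN (measurableSet_singleton n)
  have h1 := hasSum_integral_iUnion hm hd (f := f) (μ := P) hf.integrableOn
  have h2 := hasSum_integral_iUnion hm hd (f := g) (μ := P) hg.integrableOn
  rw [hU, setIntegral_univ] at h1 h2
  simp_rw [h] at h1
  exact h1.unique h2

lemma measurable_apply_nat {α β : Type*} [MeasurableSpace α] [MeasurableSpace β] {N : α → ℕ}
    (hN : Measurable N) {F : ℕ → α → β} (hF : ∀ n, Measurable (F n)) :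
    Measurable fun a => F (N a) a := by
  have : Measurable (Function.uncurry F) := measurable_from_prod_countable_right hF
  exact this.comp (hN.prodMk measurable_id)

/-- Given `N = n`, the product has mean `z ^ n` with `z = ∫ f dμ`, by independence of the marks;
averaging over `n` gives the Poisson generating function at `z`. -/
lemma integral_prod_range_poisson [IsProbabilityMeasure P] {N : Ω → ℕ} (hN : Measurable N)
    {r : ℝ≥0} (hNlaw : P.map N = poissonMeasure r) {V : ℕ → Ω → ℝ} (hV : ∀ j, Measurable (V j))
    (hVi : iIndepFun V P) {μ : Measure ℝ} (hVlaw : ∀ j, P.map (V j) = μ)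
    (hNV : IndepFun N (fun ω j => V j ω) P) {f : ℝ → ℂ} (hf : Measurable f)
    (hf1 : ∀ v, ‖f v‖ ≤ 1) :
    ∫ ω, ∏ j ∈ Finset.range (N ω), f (V j ω) ∂P = Complex.exp (r * (∫ v, f v ∂μ - 1)) := by
  set z := ∫ v, f v ∂μ with hz
  have hfV : ∀ j, ∫ ω, f (V j ω) ∂P = z := fun j => by
    rw [hz, ← hVlaw j, integral_map (hV j).aemeasurable hf.aestronglyMeasurable]
  have hz1 : ‖z‖ ≤ 1 := by
    rw [← hfV 0]
    refine (norm_integral_le_of_norm_le_const (ae_of_all _ fun ω => hf1 (V 0 ω))).trans ?_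
    simp
  have hb : ∀ n ω, ‖∏ j ∈ Finset.range n, f (V j ω)‖ ≤ 1 := fun n ω => by
    rw [norm_prod]
    exact Finset.prod_le_one (fun _ _ => norm_nonneg _) fun _ _ => hf1 _
  have hmn : ∀ n, Measurable fun ω => ∏ j ∈ Finset.range n, f (V j ω) := fun n => by fun_prop
  have hm : Measurable fun ω => ∏ j ∈ Finset.range (N ω), f (V j ω) :=
    measurable_apply_nat hN (F := fun n ω => ∏ j ∈ Finset.range n, f (V j ω)) hmn
  have hprod : ∀ n, ∫ ω, ∏ j ∈ Finset.range n, f (V j ω) ∂P = z ^ n := fun n => by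
    have h1 : iIndepFun (fun (i : Fin n) ω => f (V i ω)) P :=
      (hVi.precomp Fin.val_injective).comp (fun _ => f) fun _ => hf
    have h2 := h1.integral_fun_prod_eq_prod_integral
      (fun i => (hf.comp (hV i)).aestronglyMeasurable)
    simp_rw [Finset.prod_range, h2, hfV]
    simp
  rw [← integral_pow_poissonMeasure, ← hNlaw,
    integral_map hN.aemeasurable (measurable_of_countable _).aestronglyMeasurable]
  refine integral_eq_of_forall_setIntegral_fiber_eq hN
    (Integrable.of_bound hm.aestronglyMeasurable 1 (ae_of_all _ fun ω => hb _ ω))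
    (Integrable.of_bound ((measurable_of_countable fun n : ℕ => z ^ n).comp hN).aestronglyMeasurable
      1 (ae_of_all _ fun ω => by simpa using pow_le_one₀ (norm_nonneg _) hz1)) fun n => ?_
  have hS : MeasurableSet (N ⁻¹' {n}) := hN (measurableSet_singleton n)
  rw [setIntegral_congr_fun (f := fun ω => ∏ j ∈ Finset.range (N ω), f (V j ω))
    (g := fun ω => ∏ j ∈ Finset.range n, f (V j ω)) hS
    (fun ω hω => by rw [mem_preimage, mem_singleton_iff] at hω; simp only [hω]),
    setIntegral_congr_fun (f := fun ω => z ^ N ω) (g := fun _ => z ^ n) hS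
    (fun ω hω => by rw [mem_preimage, mem_singleton_iff] at hω; simp only [hω])]
  -- The restriction to `N = n` is written as an indicator factor, which splits off because `N` is
  -- independent of the marks.
  have hind : IndepFun (fun ω => ({n} : Set ℕ).indicator (fun _ => (1 : ℂ)) (N ω))
      (fun ω => ∏ j ∈ Finset.range n, f (V j ω)) P :=
    hNV.comp (φ := ({n} : Set ℕ).indicator (fun _ => (1 : ℂ)))
      (ψ := fun v : ℕ → ℝ => ∏ j ∈ Finset.range n, f (v j))
      (measurable_of_countable _) (by fun_prop)
  have h3 := hind.integral_fun_mul_eq_mul_integral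
    (Measurable.aestronglyMeasurable ((measurable_of_countable
      (({n} : Set ℕ).indicator (fun _ => (1 : ℂ)))).comp hN)) (hmn n).aestronglyMeasurable
  have h4 : ∀ F : Ω → ℂ, ∫ ω in N ⁻¹' {n}, F ω ∂P
      = ∫ ω, ({n} : Set ℕ).indicator (fun _ => (1 : ℂ)) (N ω) * F ω ∂P := fun F => by
    rw [← integral_indicator hS]
    refine integral_congr_ae (ae_of_all _ fun ω => ?_)
    by_cases h : N ω = n <;> simp [h]
  rw [h4, h4, h3, hprod, integral_mul_const]

/-! ### The counts of the points and of the marks have the same law -/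

/-- `V` is iid with law `Λ / Λ[0,1]` on `[0,1]`, and independent of `N(1)`. -/
structure IsMarkSequence (P : Measure Ω) (Λ : Measure ℝ) (T : ℕ → Ω → ℝ≥0∞) (V : ℕ → Ω → ℝ) :
    Prop where
  measurable : ∀ j, Measurable (V j)
  indep : iIndepFun V P
  law : ∀ j, P.map (V j) = (Λ (Icc 0 1))⁻¹ • Λ.restrict (Icc 0 1)
  indep_count : IndepFun (count T 1) (fun ω j => V j ω) P

/-- The indicator of `(w l, w (l + 1)]`, as a difference of indicators of half lines. -/
noncomputable def stepIncr (w : ℕ → ℝ) (l : ℕ) (v : ℝ) : ℝ :=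
  (Iic (w (l + 1))).indicator 1 v - (Iic (w l)).indicator 1 v

lemma measurable_stepIncr (w : ℕ → ℝ) (l : ℕ) : Measurable (stepIncr w l) :=
  (measurable_one.indicator measurableSet_Iic).sub (measurable_one.indicator measurableSet_Iic)

lemma sum_range_stepIncr (w : ℕ → ℝ) (i : ℕ) (v : ℝ) :
    ∑ l ∈ Finset.range i, stepIncr w l v
      = (Iic (w i)).indicator 1 v - (Iic (w 0)).indicator 1 v :=
  Finset.sum_range_sub (fun l => (Iic (w l)).indicator (1 : ℝ → ℝ) v) i

/-- The cells are disjoint, so `v` lies in at most one of them and at most one term of the exponent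
is nonzero. -/
lemma exp_sum_stepIncr_sub_one {w : ℕ → ℝ} (hw : Monotone w) (θ : ℕ → ℝ) (m : ℕ) (v : ℝ) :
    Complex.exp ((∑ l ∈ Finset.range m, θ l * stepIncr w l v : ℝ) * Complex.I) - 1
      = ∑ l ∈ Finset.range m, (Ioc (w l) (w (l + 1))).indicator
          (fun _ => Complex.exp (θ l * Complex.I) - 1) v := by
  induction m with
  | zero => simp
  | succ m ih =>
    rw [Finset.sum_range_succ, Finset.sum_range_succ, ← ih]
    have hle : w m ≤ w (m + 1) := hw (Nat.le_succ m)
    by_cases h1 : v ∈ Ioc (w m) (w (m + 1))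
    · have h0 : ∑ l ∈ Finset.range m, θ l * stepIncr w l v = 0 := by
        refine Finset.sum_eq_zero fun l hl => ?_
        rw [Finset.mem_range] at hl
        have a1 : w (l + 1) < v := (hw hl).trans_lt h1.1
        have a2 : w l < v := (hw hl.le).trans_lt h1.1
        simp [stepIncr, a1, a2]
      have h2 : stepIncr w m v = 1 := by
        simp [stepIncr, h1.2, h1.1]
      rw [h0, h2, indicator_of_mem h1]
      simp
    · have h2 : stepIncr w m v = 0 := by
        by_cases h : v ≤ w m
        · simp [stepIncr, h, h.trans hle]
        · have h3 : ¬ v ≤ w (m + 1) := fun h3 => h1 ⟨not_le.1 h, h3⟩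
          simp [stepIncr, h, h3]
      rw [h2, indicator_of_notMem h1]
      simp

lemma IsPoissonPoints.measure_Ioc_zero_one {Λ : Measure ℝ} {T : ℕ → Ω → ℝ≥0∞}
    (h : IsPoissonPoints P Λ T) : Λ (Ioc 0 1) = Λ (Icc 0 1) := by
  rw [← Icc_sdiff_left]
  exact measure_sdiff_null h.mean_zero

lemma IsPoissonPoints.map_count_one {Λ : Measure ℝ} {T : ℕ → Ω → ℝ≥0∞}
    (h : IsPoissonPoints P Λ T) :
    P.map (count T 1) = poissonMeasure (Λ (Icc 0 1)).toNNReal := by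
  rw [← h.measure_Ioc_zero_one, ← h.law 0 1 le_rfl zero_le_one]
  refine Measure.map_congr ?_
  filter_upwards [h.ae_count_zero] with ω hω
  simp [hω]

/-- The increments of `N` over the partition `w`. -/
noncomputable def countIncr (T : ℕ → Ω → ℝ≥0∞) (w : ℕ → ℝ) (l : ℕ) (ω : Ω) : ℝ :=
  ((count T (w (l + 1)) ω - count T (w l) ω : ℕ) : ℝ)

/-- The number of the first `N(1)` marks in the cells of the partition `w`. -/
noncomputable def markIncr (T : ℕ → Ω → ℝ≥0∞) (V : ℕ → Ω → ℝ) (w : ℕ → ℝ) (l : ℕ) (ω : Ω) : ℝ :=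
  ∑ j ∈ Finset.range (count T 1 ω), stepIncr w l (V j ω)

lemma measurable_countIncr {T : ℕ → Ω → ℝ≥0∞} (hT : ∀ j, Measurable (T j)) (w : ℕ → ℝ) (l : ℕ) :
    Measurable (countIncr T w l) :=
  (measurable_of_countable (Nat.cast : ℕ → ℝ)).comp
    ((measurable_count hT _).sub (measurable_count hT _))

lemma measurable_sum_range_count {T : ℕ → Ω → ℝ≥0∞} (hT : ∀ j, Measurable (T j))
    {V : ℕ → Ω → ℝ} (hV : ∀ j, Measurable (V j)) {f : ℝ → ℝ} (hf : Measurable f) :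
    Measurable fun ω => ∑ j ∈ Finset.range (count T 1 ω), f (V j ω) :=
  measurable_apply_nat (measurable_count hT 1)
    (F := fun n ω => ∑ j ∈ Finset.range n, f (V j ω)) fun n => by fun_prop

lemma charFun_countIncr [IsProbabilityMeasure P] {Λ : Measure ℝ} {T : ℕ → Ω → ℝ≥0∞}
    (h : IsPoissonPoints P Λ T) {w : ℕ → ℝ} (hw : Monotone w) (hw0 : w 0 = 0) (m : ℕ)
    (θ : EuclideanSpace ℝ (Fin m)) :
    charFun (P.map fun ω => WithLp.toLp 2 fun l : Fin m => countIncr T w l ω) θ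
      = ∏ l : Fin m, Complex.exp
          (Λ.real (Ioc (w l) (w (l + 1))) * (Complex.exp (θ l * Complex.I) - 1)) := by
  have hi : iIndepFun (fun (l : Fin m) => countIncr T w l) P :=
    ((h.indep.nat hw).precomp Fin.val_injective).comp (fun _ => (Nat.cast : ℕ → ℝ))
      fun _ => measurable_of_countable _
  have h1 := (iIndepFun_iff_charFun_pi
    (fun l : Fin m => (measurable_countIncr h.measurable w l).aemeasurable)).1 hi θ
  rw [h1]
  refine Finset.prod_congr rfl fun l _ => ?_
  have hpos : ∀ i, 0 ≤ w i := fun i => hw0 ▸ hw (Nat.zero_le i)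
  have h2 : P.map (countIncr T w l) = (poissonMeasure
      (Λ (Ioc (w l) (w (l + 1)))).toNNReal).map (Nat.cast : ℕ → ℝ) := by
    rw [← h.law _ _ (hpos l) (hw (Nat.le_succ l)),
      Measure.map_map (g := (Nat.cast : ℕ → ℝ))
        (f := fun ω => count T (w (l + 1)) ω - count T (w l) ω) (measurable_of_countable _)
        ((measurable_count h.measurable _).sub (measurable_count h.measurable _))]
    rfl
  rw [h2, charFun_map_cast_poissonMeasure]
  rfl

/-- A linear combination of the cell counts is a sum over marks, so its exponential is a product `∏
f (V j)` and `integral_prod_range_poisson` applies; `f - 1` then splits over the cells. -/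
lemma charFun_markIncr [IsProbabilityMeasure P] {Λ : Measure ℝ} {T : ℕ → Ω → ℝ≥0∞}
    (h : IsPoissonPoints P Λ T) (hΛ : Λ (Icc 0 1) ≠ 0) {V : ℕ → Ω → ℝ}
    (hV : IsMarkSequence P Λ T V) {w : ℕ → ℝ} (hw : Monotone w) (hw0 : w 0 = 0) {m : ℕ}
    (hwm : w m = 1) (θ : EuclideanSpace ℝ (Fin m)) :
    charFun (P.map fun ω => WithLp.toLp 2 fun l : Fin m => markIncr T V w l ω) θ
      = ∏ l : Fin m, Complex.exp
          (Λ.real (Ioc (w l) (w (l + 1))) * (Complex.exp (θ l * Complex.I) - 1)) := by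
  have hm : Measurable fun ω => WithLp.toLp 2 fun l : Fin m => markIncr T V w l ω :=
    (WithLp.measurable_toLp 2 _).comp (measurable_pi_lambda _ fun l =>
      measurable_sum_range_count h.measurable hV.measurable (measurable_stepIncr w l))
  set θ' : ℕ → ℝ := fun l => if hl : l < m then θ ⟨l, hl⟩ else 0 with hθ'
  have hθ : ∀ l : Fin m, θ' l = θ l := fun l => by simp [hθ']
  set f : ℝ → ℂ := fun v =>
    Complex.exp ((∑ l ∈ Finset.range m, θ' l * stepIncr w l v : ℝ) * Complex.I) with hf
  have hfm : Measurable f := by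
    have : Measurable fun v => ∑ l ∈ Finset.range m, θ' l * stepIncr w l v :=
      Finset.measurable_sum _ fun l _ => (measurable_stepIncr w l).const_mul _
    fun_prop
  have hf1 : ∀ v, ‖f v‖ ≤ 1 := fun v => (Complex.norm_exp_ofReal_mul_I _).le
  have key := integral_prod_range_poisson (measurable_count h.measurable 1) h.map_count_one
    hV.measurable hV.indep hV.law hV.indep_count hfm hf1
  have hfin : Λ (Icc 0 1) ≠ ∞ := (h.mean_finite 1).ne
  have : IsFiniteMeasure (Λ.restrict (Icc 0 1)) := ⟨by simpa using h.mean_finite 1⟩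
  have hfi : Integrable f (Λ.restrict (Icc 0 1)) :=
    Integrable.of_bound hfm.aestronglyMeasurable 1 (ae_of_all _ hf1)
  -- The normalisation `1 / Λ[0,1]` of the mark law cancels against the Poisson mean `Λ[0,1]`.
  have hstep : (((Λ (Icc 0 1)).toNNReal : ℝ≥0) : ℂ) *
      (∫ v, f v ∂((Λ (Icc 0 1))⁻¹ • Λ.restrict (Icc 0 1)) - 1)
      = ∫ v in Icc 0 1, (f v - 1) ∂Λ := by
    rw [integral_sub hfi (integrable_const _), integral_smul_measure]
    have h0 : (Λ (Icc 0 1)).toReal ≠ 0 := ENNReal.toReal_ne_zero.2 ⟨hΛ, hfin⟩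
    have h0' : ((Λ (Icc 0 1)).toReal : ℂ) ≠ 0 := by exact_mod_cast h0
    have e1 : (((Λ (Icc 0 1)).toNNReal : ℝ≥0) : ℂ) = ((Λ (Icc 0 1)).toReal : ℂ) := rfl
    rw [e1, ENNReal.toReal_inv, Complex.real_smul]
    simp only [integral_const, Measure.real, Complex.real_smul, Measure.restrict_apply_univ]
    push_cast
    field_simp
  have hsum : ∫ v in Icc 0 1, (f v - 1) ∂Λ = ∑ l ∈ Finset.range m,
      (Λ.real (Ioc (w l) (w (l + 1))) : ℂ) * (Complex.exp (θ' l * Complex.I) - 1) := by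
    simp_rw [hf, exp_sum_stepIncr_sub_one hw]
    rw [integral_finsetSum _ fun l _ => (integrable_const _).indicator measurableSet_Ioc]
    refine Finset.sum_congr rfl fun l hl => ?_
    rw [integral_indicator measurableSet_Ioc, Measure.restrict_restrict measurableSet_Ioc,
      inter_eq_left.2]
    · simp
    · rw [Finset.mem_range] at hl
      -- Every cell lies in `[0,1]`, because `w` runs from `0` to `1`; the restriction of `Λ` is
      -- therefore harmless.
      exact fun v hv => ⟨(hw0 ▸ hw (Nat.zero_le l)).trans hv.1.le, hv.2.trans (hwm ▸ hw hl)⟩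
  rw [hstep, hsum, Complex.exp_sum, Finset.prod_range] at key
  simp_rw [hθ] at key
  rw [← key, charFun_apply, integral_map hm.aemeasurable (by fun_prop)]
  refine integral_congr_ae (ae_of_all _ fun ω => ?_)
  simp only [hf]
  rw [← Complex.exp_sum, ← Finset.sum_mul, ← Complex.ofReal_sum, Finset.sum_comm]
  congr 3
  rw [PiLp.inner_apply, Finset.sum_range]
  refine Finset.sum_congr rfl fun l _ => ?_
  simp [markIncr, hθ, Finset.mul_sum]

lemma map_countIncr_eq_map_markIncr [IsProbabilityMeasure P] {Λ : Measure ℝ} {T : ℕ → Ω → ℝ≥0∞}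
    (h : IsPoissonPoints P Λ T) (hΛ : Λ (Icc 0 1) ≠ 0) {V : ℕ → Ω → ℝ}
    (hV : IsMarkSequence P Λ T V) {w : ℕ → ℝ} (hw : Monotone w) (hw0 : w 0 = 0) {m : ℕ}
    (hwm : w m = 1) :
    P.map (fun ω (l : Fin m) => countIncr T w l ω) = P.map (fun ω (l : Fin m) => markIncr T V w l ω)
    := by
  have m1 : Measurable fun ω (l : Fin m) => countIncr T w l ω :=
    measurable_pi_lambda _ fun l => measurable_countIncr h.measurable w l
  have m2 : Measurable fun ω (l : Fin m) => markIncr T V w l ω := measurable_pi_lambda _ fun l =>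
      measurable_sum_range_count h.measurable hV.measurable (measurable_stepIncr w l)
  have h1 : P.map (fun ω => WithLp.toLp 2 fun l : Fin m => countIncr T w l ω)
      = P.map (fun ω => WithLp.toLp 2 fun l : Fin m => markIncr T V w l ω) := by
    have := Measure.isProbabilityMeasure_map (μ := P)
      ((WithLp.measurable_toLp 2 _).comp m1).aemeasurable
    have := Measure.isProbabilityMeasure_map (μ := P)
      ((WithLp.measurable_toLp 2 _).comp m2).aemeasurable
    refine Measure.ext_of_charFun (funext fun θ => ?_)
    exact (charFun_countIncr h hw hw0 m θ).trans (charFun_markIncr h hΛ hV hw hw0 hwm θ).symm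
  have h2 := congrArg (Measure.map (WithLp.ofLp (p := 2) (V := Fin m → ℝ))) h1
  have c1 := Measure.map_map (μ := P) (WithLp.measurable_ofLp 2 (Fin m → ℝ))
    ((WithLp.measurable_toLp 2 _).comp m1)
  have c2 := Measure.map_map (μ := P) (WithLp.measurable_ofLp 2 (Fin m → ℝ))
    ((WithLp.measurable_toLp 2 _).comp m2)
  exact (c1.symm.trans h2).trans c2

/-! ### The order statistics property -/

lemma IsMarkSequence.ae_mem_Ioc {Λ : Measure ℝ} {T : ℕ → Ω → ℝ≥0∞} {V : ℕ → Ω → ℝ}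
    (h : IsPoissonPoints P Λ T) (hV : IsMarkSequence P Λ T V) :
    ∀ᵐ ω ∂P, ∀ j, V j ω ∈ Ioc (0 : ℝ) 1 := by
  rw [ae_all_iff]
  intro j
  have h1 : ∀ᵐ v ∂(P.map (V j)), v ∈ Ioc (0 : ℝ) 1 := by
    rw [hV.law j]
    refine Measure.ae_smul_measure ?_ _
    rw [ae_restrict_iff' measurableSet_Icc]
    have h0 : ∀ᵐ v ∂Λ, v ≠ 0 := by
      rw [ae_iff]
      simpa using h.mean_zero
    filter_upwards [h0] with v hv hv'
    exact ⟨lt_of_le_of_ne hv'.1 hv.symm, hv'.2⟩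
  exact ae_of_ae_map (hV.measurable j).aemeasurable h1

/-- The number of the first `N(1)` marks in `(-∞, a]`. -/
noncomputable def markCount (T : ℕ → Ω → ℝ≥0∞) (V : ℕ → Ω → ℝ) (a : ℝ) (ω : Ω) : ℝ :=
  ∑ j ∈ Finset.range (count T 1 ω), (Iic a).indicator 1 (V j ω)

lemma sum_fin_ite_lt {i m : ℕ} (him : i ≤ m) (d : ℕ → ℝ) :
    (∑ l : Fin m, if (l : ℕ) < i then d l else 0) = ∑ l ∈ Finset.range i, d l := by
  rw [Fin.sum_univ_eq_sum_range (fun l => if l < i then d l else 0) m, ← Finset.sum_filter]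
  congr 1
  ext l
  simp only [Finset.mem_filter, Finset.mem_range]
  omega

lemma exists_partition {n : ℕ} (u : Fin n → ℝ) (hu : ∀ k, u k ∈ Icc (0 : ℝ) 1) :
    ∃ w : ℕ → ℝ, Monotone w ∧ w 0 = 0 ∧ w (n + 1) = 1 ∧ ∃ i : Fin n → ℕ, ∀ k,
      i k ≤ n + 1 ∧ w (i k) = u k := by
  -- The partition is `0`, then the sorted values of `u`, then `1`; the initial `0` shifts ranks by
  -- one.
  refine ⟨fun i => if i = 0 then 0 else if h : i - 1 < n then u (Tuple.sort u ⟨i - 1, h⟩) else 1,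
    ?_, by simp, by simp, fun k => (Tuple.sort u).symm k + 1, fun k => ⟨?_, by simp⟩⟩
  · intro a b hab
    rcases Nat.eq_zero_or_pos a with rfl | ha
    · by_cases hb : b = 0
      · simp [hb]
      · by_cases hb' : b - 1 < n
        · simpa [hb, hb'] using (hu _).1
        · simp [hb, hb']
    · have hb : b ≠ 0 := by omega
      by_cases hb' : b - 1 < n
      · have ha' : a - 1 < n := by omega
        simp only [ha.ne', hb, hb', ha', if_false, dif_pos]
        exact Tuple.monotone_sort u (show (⟨a - 1, ha'⟩ : Fin n) ≤ ⟨b - 1, hb'⟩ by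
          simp only [Fin.mk_le_mk]; omega)
      · by_cases ha' : a - 1 < n
        · simpa [ha.ne', hb, hb', ha'] using (hu _).2
        · simp [ha.ne', hb, hb', ha']
  · exact Nat.succ_le_succ ((Tuple.sort u).symm k).2.le

/-- Counts up to given times are partial sums of cell counts, over a partition containing those
times. The linear map `ψ` forms these sums, with `N(1)` as the full sum. -/
lemma map_count_eq_map_markCount [IsProbabilityMeasure P] {Λ : Measure ℝ} {T : ℕ → Ω → ℝ≥0∞}
    (h : IsPoissonPoints P Λ T) (hΛ : Λ (Icc 0 1) ≠ 0) {V : ℕ → Ω → ℝ}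
    (hV : IsMarkSequence P Λ T V) {n : ℕ} (u : Fin n → ℝ) (hu : ∀ k, u k ∈ Icc (0 : ℝ) 1) :
    P.map (fun ω => ((count T 1 ω : ℝ), fun k => (count T (u k) ω : ℝ)))
      = P.map (fun ω => ((count T 1 ω : ℝ), fun k => markCount T V (u k) ω)) := by
  obtain ⟨w, hw, hw0, hw1, i, hi⟩ := exists_partition u hu
  set ψ : (Fin (n + 1) → ℝ) → ℝ × (Fin n → ℝ) := fun d =>
    (∑ l : Fin (n + 1), if (l : ℕ) < n + 1 then d l else 0,
      fun k => ∑ l : Fin (n + 1), if (l : ℕ) < i k then d l else 0) with hψ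
  have hψm : Measurable ψ := by
    refine Measurable.prodMk (Finset.measurable_sum _ fun l _ => ?_)
      (measurable_pi_lambda _ fun k => Finset.measurable_sum _ fun l _ => ?_)
    · split_ifs <;> fun_prop
    · split_ifs <;> fun_prop
  have m1 : Measurable fun ω (l : Fin (n + 1)) => countIncr T w l ω :=
    measurable_pi_lambda _ fun l => measurable_countIncr h.measurable w l
  have m2 : Measurable fun ω (l : Fin (n + 1)) => markIncr T V w l ω :=
    measurable_pi_lambda _ fun l =>
      measurable_sum_range_count h.measurable hV.measurable (measurable_stepIncr w l)
  have key := congrArg (Measure.map ψ) (map_countIncr_eq_map_markIncr h hΛ hV hw hw0 hw1)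
  rw [Measure.map_map hψm m1, Measure.map_map hψm m2] at key
  have e1 : (ψ ∘ fun ω (l : Fin (n + 1)) => countIncr T w l ω)
      =ᵐ[P] fun ω => ((count T 1 ω : ℝ), fun k => (count T (u k) ω : ℝ)) := by
    filter_upwards [h.ae_count_zero, h.ae_monotone_count] with ω h0 hmono
    have hs : ∀ j, ∑ l ∈ Finset.range j, countIncr T w l ω = (count T (w j) ω : ℝ) := fun j => by
      have : ∀ l, countIncr T w l ω = (count T (w (l + 1)) ω : ℝ) - count T (w l) ω := fun l =>
        Nat.cast_sub (hmono (hw (Nat.le_succ l)))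
      simp_rw [this]
      rw [Finset.sum_range_sub (fun l => (count T (w l) ω : ℝ)), hw0, h0]
      simp
    refine Prod.ext ?_ (funext fun k => ?_)
    · change (∑ l : Fin (n + 1), if (l : ℕ) < n + 1 then countIncr T w l ω else 0) = _
      rw [sum_fin_ite_lt le_rfl (fun l => countIncr T w l ω), hs, hw1]
    · change (∑ l : Fin (n + 1), if (l : ℕ) < i k then countIncr T w l ω else 0) = _
      rw [sum_fin_ite_lt (hi k).1 (fun l => countIncr T w l ω), hs, (hi k).2]
  have e2 : (ψ ∘ fun ω (l : Fin (n + 1)) => markIncr T V w l ω)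
      =ᵐ[P] fun ω => ((count T 1 ω : ℝ), fun k => markCount T V (u k) ω) := by
    filter_upwards [hV.ae_mem_Ioc h] with ω hω
    have hs : ∀ j, ∑ l ∈ Finset.range j, markIncr T V w l ω = markCount T V (w j) ω := fun j => by
      simp only [markIncr, markCount]
      rw [Finset.sum_comm]
      refine Finset.sum_congr rfl fun q _ => ?_
      rw [sum_range_stepIncr, hw0, indicator_of_notMem (s := Iic (0 : ℝ)), sub_zero]
      exact not_le.2 (hω q).1
    refine Prod.ext ?_ (funext fun k => ?_)
    · change (∑ l : Fin (n + 1), if (l : ℕ) < n + 1 then markIncr T V w l ω else 0) = _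
      rw [sum_fin_ite_lt le_rfl (fun l => markIncr T V w l ω), hs, hw1, markCount]
      rw [Finset.sum_congr rfl fun q _ => indicator_of_mem (s := Iic (1 : ℝ)) (hω q).2 1]
      simp
    · change (∑ l : Fin (n + 1), if (l : ℕ) < i k then markIncr T V w l ω else 0) = _
      rw [sum_fin_ite_lt (hi k).1 (fun l => markIncr T V w l ω), hs, (hi k).2]
  rw [← Measure.map_congr e1, ← Measure.map_congr e2, key]

lemma card_filter_comp_perm {n : ℕ} (v : Fin n → ℝ) (σ : Equiv.Perm (Fin n)) (a : ℝ) :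
    (Finset.univ.filter fun i => (v ∘ σ) i ≤ a).card = (Finset.univ.filter fun i => v i ≤ a).card :=
  Finset.card_equiv σ (by simp)

lemma sort_apply_le_iff {n : ℕ} (v : Fin n → ℝ) (k : Fin n) (a : ℝ) :
    (v ∘ Tuple.sort v) k ≤ a ↔ (k : ℕ) < (Finset.univ.filter fun i => v i ≤ a).card := by
  rw [← card_filter_comp_perm v (Tuple.sort v) a,
    Tuple.lt_card_le_iff_apply_le_of_monotone (Tuple.monotone_sort v)]

/-- By `sort_apply_le_iff`, the sublevel sets of each order statistic are conditions on a sum of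
indicators. -/
lemma measurable_comp_sort (n : ℕ) : Measurable fun v : Fin n → ℝ => v ∘ Tuple.sort v := by
  refine measurable_pi_lambda _ fun k => measurable_of_Iic fun a => ?_
  have : (fun v : Fin n → ℝ => (v ∘ Tuple.sort v) k) ⁻¹' Iic a
      = {v | (k : ℕ) < ∑ i, if v i ≤ a then 1 else 0} := by
    ext v
    rw [mem_preimage, mem_Iic, sort_apply_le_iff, Finset.card_filter]
    rfl
  rw [this]
  exact measurableSet_lt measurable_const (Finset.measurable_sum _ fun i _ =>
    Measurable.ite (measurableSet_le (measurable_pi_apply i) measurable_const)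
      measurable_const measurable_const)

lemma isCountablySpanning_range_Iic : IsCountablySpanning (range (Iic : ℝ → Set ℝ)) :=
  ⟨fun n : ℕ => Iic (n : ℝ), fun _ => mem_range_self _,
    iUnion_eq_univ_iff.2 fun x => (exists_nat_ge x).imp fun _ h => h⟩

lemma ext_of_pi_Iic {n : ℕ} {μ ν : Measure (Fin n → ℝ)} [IsFiniteMeasure μ]
    (h : ∀ u : Fin n → ℝ, μ {v | ∀ k, v k ≤ u k} = ν {v | ∀ k, v k ≤ u k})
    (huniv : μ univ = ν univ) : μ = ν := by
  refine ext_of_generate_finite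
    (Set.univ.pi '' Set.univ.pi fun _ : Fin n => range (Iic : ℝ → Set ℝ)) ?_
    (IsPiSystem.pi fun _ => isPiSystem_Iic) ?_ huniv
  · rw [← @generateFrom_pi_eq (Fin n) (fun _ => ℝ) _ (fun _ => range Iic)
      fun _ => isCountablySpanning_range_Iic, ← borel_eq_generateFrom_Iic,
      ← BorelSpace.measurable_eq]
  · rintro _ ⟨s, hs, rfl⟩
    choose u hu using fun k => hs k (mem_univ k)
    convert h u using 2 <;> ext v <;> simp [← hu, Set.mem_pi]

/-- Given `N(1) = n`, the points of the Poisson process in `[0,1]` are distributed as the order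
statistics of `n` iid marks. -/
lemma map_points_eq_map_sort [IsProbabilityMeasure P] {Λ : Measure ℝ} {T : ℕ → Ω → ℝ≥0∞}
    (h : IsPoissonPoints P Λ T) (hΛ : Λ (Icc 0 1) ≠ 0) {V : ℕ → Ω → ℝ}
    (hV : IsMarkSequence P Λ T V) (n : ℕ) :
    (P.restrict (count T 1 ⁻¹' {n})).map (fun ω (k : Fin n) => (T k ω).toReal)
      = (P.restrict (count T 1 ⁻¹' {n})).map
        (fun ω => (fun k : Fin n => V k ω) ∘ Tuple.sort fun k : Fin n => V k ω) := by
  have mT : Measurable fun ω (k : Fin n) => (T k ω).toReal :=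
    measurable_pi_lambda _ fun k => (h.measurable k).ennreal_toReal
  have mV : Measurable fun ω => (fun k : Fin n => V k ω) ∘ Tuple.sort fun k : Fin n => V k ω :=
    (measurable_comp_sort n).comp (measurable_pi_lambda _ fun k => hV.measurable k)
  have hN : MeasurableSet (count T 1 ⁻¹' {n}) :=
    measurable_count h.measurable 1 (measurableSet_singleton n)
  refine ext_of_pi_Iic (fun u => ?_) ?_
  · have hS : MeasurableSet {v : Fin n → ℝ | ∀ k, v k ≤ u k} := by
      rw [ofPred_forall]
      exact MeasurableSet.iInter fun k =>
        measurableSet_le (measurable_pi_apply k) measurable_const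
    rw [Measure.map_apply mT hS, Measure.map_apply mV hS, Measure.restrict_apply (mT hS),
      Measure.restrict_apply (mV hS)]
    -- Law equality of counts is available for times in `[0,1]` only, so `u` is clamped. On `N(1) =
    -- n` this changes neither event: the relevant points and marks lie in `(0,1]` a.s., and strict
    -- positivity covers the case `u k < 0`.
    set c : Fin n → ℝ := fun k => max 0 (min (u k) 1) with hc
    have hc01 : ∀ k, c k ∈ Icc (0 : ℝ) 1 := fun k =>
      ⟨le_max_left _ _, max_le zero_le_one (min_le_right _ _)⟩
    have key := map_count_eq_map_markCount h hΛ hV c hc01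
    set R : Set (ℝ × (Fin n → ℝ)) := {p | p.1 = n ∧ ∀ k : Fin n, ((k : ℕ) : ℝ) < p.2 k} with hR
    have hRm : MeasurableSet R := by
      rw [hR, ofPred_and, ofPred_forall]
      exact (measurableSet_eq_fun measurable_fst measurable_const).inter
        (MeasurableSet.iInter fun k => measurableSet_lt measurable_const
          ((measurable_pi_apply k).comp measurable_snd))
    have m1 : Measurable fun ω => ((count T 1 ω : ℝ), fun k => (count T (c k) ω : ℝ)) :=
      ((measurable_of_countable (Nat.cast : ℕ → ℝ)).comp (measurable_count h.measurable 1)).prodMk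
        (measurable_pi_lambda _ fun k =>
          (measurable_of_countable (Nat.cast : ℕ → ℝ)).comp (measurable_count h.measurable _))
    have m2 : Measurable fun ω => ((count T 1 ω : ℝ), fun k => markCount T V (c k) ω) :=
      ((measurable_of_countable (Nat.cast : ℕ → ℝ)).comp (measurable_count h.measurable 1)).prodMk
        (measurable_pi_lambda _ fun k => measurable_sum_range_count h.measurable hV.measurable
          (measurable_one.indicator measurableSet_Iic))
    have key2 := congrArg (fun μ => μ R) key
    simp only [Measure.map_apply m1 hRm, Measure.map_apply m2 hRm] at key2
    refine (measure_congr (eventuallyEq_set.2 ?_)).trans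
      (key2.trans (measure_congr (eventuallyEq_set.2 ?_)))
    · filter_upwards [h.ae_lt_count_iff, h.ae_count_zero] with ω hcount h0
      change ((∀ k : Fin n, (T k ω).toReal ≤ u k) ∧ count T 1 ω = n) ↔
        ((count T 1 ω : ℝ) = n ∧ ∀ k : Fin n, ((k : ℕ) : ℝ) < (count T (c k) ω : ℝ))
      rw [and_comm, Nat.cast_inj]
      refine and_congr_right fun hn => forall_congr' fun k => ?_
      rw [Nat.cast_lt, hcount]
      have hT1 : T k ω ≤ 1 := by
        have := (hcount 1 k).1 (hn ▸ k.2)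
        simpa using this
      have hTtop : T k ω ≠ ∞ := (hT1.trans_lt ENNReal.one_lt_top).ne
      have hT1' : (T k ω).toReal ≤ 1 := by
        simpa using ENNReal.toReal_mono ENNReal.one_ne_top hT1
      have hT0 : 0 < (T k ω).toReal := by
        refine ENNReal.toReal_pos (fun hz => ?_) hTtop
        have := (hcount 0 k).2 (by simp [hz])
        omega
      rw [ENNReal.le_ofReal_iff_toReal_le hTtop (hc01 k).1, hc]
      simp only [le_max_iff, le_min_iff, hT1', and_true, not_le.2 hT0, false_or]
    · filter_upwards [hV.ae_mem_Ioc h] with ω hω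
      change ((count T 1 ω : ℝ) = n ∧ ∀ k : Fin n, ((k : ℕ) : ℝ) < markCount T V (c k) ω) ↔
        ((∀ k : Fin n, ((fun k : Fin n => V k ω) ∘ Tuple.sort fun k : Fin n => V k ω) k ≤ u k) ∧
          count T 1 ω = n)
      rw [and_comm (b := count T 1 ω = n), Nat.cast_inj]
      refine and_congr_right fun hn => forall_congr' fun k => ?_
      rw [sort_apply_le_iff, markCount, hn, Finset.sum_range, Finset.card_filter, ← Nat.cast_lt (α := ℝ),
        Nat.cast_sum]
      refine iff_of_eq (congrArg _ (Finset.sum_congr rfl fun q _ => ?_))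
      have hq := hω q
      have : V q ω ≤ c k ↔ V q ω ≤ u k := by
        rw [hc]
        simp only [le_max_iff, le_min_iff, hq.2, and_true, not_le.2 hq.1, false_or]
      by_cases hle : V q ω ≤ u k
      · simp [this.2 hle, hle]
      · simp [mt this.1 hle, hle]
  · rw [Measure.map_apply mT .univ, Measure.map_apply mV .univ]
    rfl

/-- Symmetry is asked only for vectors bounded by `1`: the intended `g` is symmetric only where all
times `t - v k` are nonnegative. -/
lemma setIntegral_points_eq_setIntegral_marks [IsProbabilityMeasure P] {Λ : Measure ℝ}
    {T : ℕ → Ω → ℝ≥0∞} (h : IsPoissonPoints P Λ T) (hΛ : Λ (Icc 0 1) ≠ 0) {V : ℕ → Ω → ℝ}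
    (hV : IsMarkSequence P Λ T V) {n : ℕ} {E : Type*} [NormedAddCommGroup E] [NormedSpace ℝ E]
    {g : (Fin n → ℝ) → E} (hg : StronglyMeasurable g)
    (hsymm : ∀ v : Fin n → ℝ, (∀ k, v k ≤ 1) → ∀ σ : Equiv.Perm (Fin n), g (v ∘ σ) = g v) :
    ∫ ω in count T 1 ⁻¹' {n}, g (fun k => (T k ω).toReal) ∂P
      = ∫ ω in count T 1 ⁻¹' {n}, g (fun k => V k ω) ∂P := by
  have mT : Measurable fun ω (k : Fin n) => (T k ω).toReal :=
    measurable_pi_lambda _ fun k => (h.measurable k).ennreal_toReal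
  have mV : Measurable fun ω => (fun k : Fin n => V k ω) ∘ Tuple.sort fun k : Fin n => V k ω :=
    (measurable_comp_sort n).comp (measurable_pi_lambda _ fun k => hV.measurable k)
  rw [← integral_map mT.aemeasurable hg.aestronglyMeasurable, map_points_eq_map_sort h hΛ hV,
    integral_map mV.aemeasurable hg.aestronglyMeasurable]
  refine integral_congr_ae ?_
  filter_upwards [ae_restrict_of_ae (hV.ae_mem_Ioc h)] with ω hω
  exact hsymm _ (fun k => (hω k).2) _

/-! ### Jointly measurable evaluation of right-continuous paths -/

/-- Evaluation of a path at `u` as a limit from the right along a grid. -/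
noncomputable def rightEval (u : ℝ) (l : ℝ → ℝ) : ℝ :=
  limsup (fun n : ℕ => l ((⌊u * (n + 1)⌋ + 1) / (n + 1))) atTop

/-- Plain evaluation `(u, l) ↦ l u` is not measurable for the product σ-algebra on `ℝ → ℝ`. The grid
version is: at each level the coordinate read is selected by an integer-valued measurable floor. -/
lemma measurable_rightEval {α : Type*} [MeasurableSpace α] {u : α → ℝ} {l : α → ℝ → ℝ}
    (hu : Measurable u) (hl : Measurable l) : Measurable fun a => rightEval (u a) (l a) := by
  refine Measurable.limsup fun n => ?_
  have h1 : Measurable (Function.uncurry fun (z : ℤ) (l : ℝ → ℝ) => l ((z + 1) / (n + 1))) :=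
    measurable_from_prod_countable_right fun z =>
      measurable_pi_apply (((z : ℝ) + 1) / (n + 1))
  have h2 : Measurable fun a => (⌊u a * (n + 1)⌋, l a) :=
    (Int.measurable_floor.comp (hu.mul_const _)).prodMk hl
  exact h1.comp h2

/-- The grid points lie strictly to the right of `u`, within `1 / (n + 1)`, so right-continuity
makes the limsup a limit. -/
lemma rightEval_eq {u : ℝ} {l : ℝ → ℝ} (h : ContinuousWithinAt l (Ici u) u) :
    rightEval u l = l u := by
  refine Tendsto.limsup_eq (h.tendsto.comp (tendsto_nhdsWithin_iff.2 ⟨?_, ?_⟩))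
  · have h0 : Tendsto (fun n : ℕ => u + 1 / ((n : ℝ) + 1)) atTop (𝓝 u) := by
      simpa using tendsto_one_div_add_atTop_nhds_zero_nat.const_add u
    refine tendsto_of_tendsto_of_tendsto_of_le_of_le tendsto_const_nhds h0 (fun n => ?_)
      fun n => ?_
    · have hn : (0 : ℝ) < n + 1 := by positivity
      exact (le_div_iff₀ hn).2 (Int.lt_floor_add_one _).le
    · have hn : (0 : ℝ) < n + 1 := by positivity
      rw [div_le_iff₀ hn, add_mul, one_div_mul_cancel hn.ne']
      linarith [Int.floor_le (u * ((n : ℝ) + 1))]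
  · refine Eventually.of_forall fun n => ?_
    have hn : (0 : ℝ) < n + 1 := by positivity
    exact (le_div_iff₀ hn).2 (Int.lt_floor_add_one _).le

lemma IsAdditiveProcess.ae_rightEval_eq {X : ℝ → Ω → ℝ} (h : IsAdditiveProcess P X) :
    ∀ᵐ ω ∂P, ∀ u, rightEval u (fun t => X t ω) = X u ω := by
  filter_upwards [h.cadlag] with ω hω u
  exact rightEval_eq (hω u).1

/-! ### Increments of a jump-type additive process -/

lemma IsJumpAdditiveProcess.additive {ν : Measure (ℝ × ℝ)} {X : ℝ → Ω → ℝ}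
    (h : IsJumpAdditiveProcess P ν X) : IsAdditiveProcess P X :=
  ⟨h.measurable, h.zero, h.indep, h.stochCont, h.cadlag⟩

/-- Domination: `|e^{ixv} - 1| ≤ min(|x||v|, 2) ≤ max(|x|, 2) · min(|v|, 1)`. -/
lemma IsJumpIntensity.integrableOn {ν : Measure (ℝ × ℝ)} (h : IsJumpIntensity ν) (x : ℝ) {t : ℝ}
    (ht : 0 ≤ t) :
    IntegrableOn (fun p : ℝ × ℝ => Complex.exp (Complex.I * x * p.2) - 1) (Ioc 0 t ×ˢ univ) ν := by
  have h1 : Integrable (fun p : ℝ × ℝ => min |p.2| 1) (ν.restrict (Ioc 0 t ×ˢ univ)) := by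
    refine ⟨by fun_prop, ?_⟩
    rw [hasFiniteIntegral_iff_ofReal (ae_of_all _ fun p => by positivity)]
    exact h.integrable t ht
  refine (h1.const_mul (max |x| 2)).mono' (by fun_prop) (ae_of_all _ fun p => ?_)
  have e : Complex.I * x * p.2 = Complex.I * ((x * p.2 : ℝ) : ℂ) := by push_cast; ring
  rw [e]
  have b1 : ‖Complex.exp (Complex.I * ((x * p.2 : ℝ) : ℂ)) - 1‖ ≤ |x| * |p.2| := by
    rw [← abs_mul]
    exact Real.norm_exp_I_mul_ofReal_sub_one_le
  have b2 : ‖Complex.exp (Complex.I * ((x * p.2 : ℝ) : ℂ)) - 1‖ ≤ 2 := by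
    refine (norm_sub_le _ _).trans ?_
    rw [mul_comm Complex.I, Complex.norm_exp_ofReal_mul_I]
    norm_num
  rcases le_total |p.2| 1 with hp | hp
  · rw [min_eq_left hp]
    exact b1.trans (mul_le_mul_of_nonneg_right (le_max_left _ _) (abs_nonneg _))
  · rw [min_eq_right hp, mul_one]
    exact b2.trans (le_max_right _ _)

lemma IsJumpIntensity.jumpExponent_add {ν : Measure (ℝ × ℝ)} (h : IsJumpIntensity ν) (x : ℝ)
    {a b : ℝ} (ha : 0 ≤ a) (hab : a ≤ b) :
    jumpExponent ν x 0 a + jumpExponent ν x a b = jumpExponent ν x 0 b := by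
  have hi := h.integrableOn x (ha.trans hab)
  have e : Ioc (0 : ℝ) b ×ˢ (univ : Set ℝ) = Ioc 0 a ×ˢ univ ∪ Ioc a b ×ˢ univ := by
    rw [← union_prod, Ioc_union_Ioc_eq_Ioc ha hab]
  have hd : Disjoint (Ioc (0 : ℝ) a ×ˢ (univ : Set ℝ)) (Ioc a b ×ˢ univ) :=
    Disjoint.set_prod_left (Ioc_disjoint_Ioc_of_le le_rfl) _ _
  rw [e] at hi
  unfold jumpExponent
  rw [e, setIntegral_union hd (measurableSet_Ioc.prod .univ) hi.left_of_union hi.right_of_union]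

lemma IsAdditiveProcess.iIndepFun_increments {X : ℝ → Ω → ℝ} (h : IsAdditiveProcess P X) {a b : ℝ}
    (ha : 0 ≤ a) (hab : a ≤ b) :
    iIndepFun (fun (k : Fin 2) ω => X (![0, a, b] k.succ) ω - X (![0, a, b] k.castSucc) ω) P := by
  refine h.indep 2 ![0, a, b] (Fin.monotone_iff_le_succ.2 fun k => ?_)
  fin_cases k <;> simpa

/-- The characteristic function at time `b` factors over `(0,a]` and `(a,b]`; the first factor is an
exponential, hence nonzero, and cancels. -/
lemma IsJumpAdditiveProcess.integral_exp_increment [IsProbabilityMeasure P] {ν : Measure (ℝ × ℝ)}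
    (hν : IsJumpIntensity ν) {X : ℝ → Ω → ℝ} (h : IsJumpAdditiveProcess P ν X) (x : ℝ) {a b : ℝ}
    (ha : 0 ≤ a) (hab : a ≤ b) :
    ∫ ω, Complex.exp (Complex.I * x * ((X b ω - X a ω : ℝ) : ℂ)) ∂P
      = Complex.exp (jumpExponent ν x a b) := by
  have mX := h.measurable
  have hi : IndepFun (fun ω => X a ω - X 0 ω) (fun ω => X b ω - X a ω) P := by
    simpa using (h.additive.iIndepFun_increments ha hab).indepFun
      (i := 0) (j := 1) (by decide)
  have hm : Measurable fun y : ℝ => Complex.exp (Complex.I * x * (y : ℂ)) := by fun_prop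
  have h1 := (hi.comp hm hm).integral_fun_mul_eq_mul_integral
    (hm.comp ((mX a).sub (mX 0))).aestronglyMeasurable
    (hm.comp ((mX b).sub (mX a))).aestronglyMeasurable
  simp only [Function.comp_apply] at h1
  have e1 : ∫ ω, Complex.exp (Complex.I * x * ((X a ω - X 0 ω : ℝ) : ℂ)) ∂P
      = Complex.exp (jumpExponent ν x 0 a) := by
    rw [← h.charFun_eq a ha x]
    refine integral_congr_ae ?_
    filter_upwards [h.zero] with ω hω
    rw [hω 0 le_rfl, sub_zero]
  have e2 : ∫ ω, Complex.exp (Complex.I * x * ((X a ω - X 0 ω : ℝ) : ℂ))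
      * Complex.exp (Complex.I * x * ((X b ω - X a ω : ℝ) : ℂ)) ∂P
      = Complex.exp (jumpExponent ν x 0 b) := by
    rw [← h.charFun_eq b (ha.trans hab) x]
    refine integral_congr_ae ?_
    filter_upwards [h.zero] with ω hω
    rw [hω 0 le_rfl, ← Complex.exp_add]
    push_cast
    ring_nf
  rw [e1, e2, ← hν.jumpExponent_add x ha hab, Complex.exp_add] at h1
  exact (mul_left_cancel₀ (Complex.exp_ne_zero _) h1).symm

/-! ### Sums of independent processes at deterministic times -/

section Sums

variable {ν : Measure (ℝ × ℝ)} {L : ℕ → ℝ → Ω → ℝ}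

/-- Independence across processes and across increments makes all `2n` variables `Y i k` jointly
independent. Past and future are sums over the disjoint index blocks `k = 0` and `k = 1`; since `L i
0 = 0` a.s., the first increment is the value at `a i`. -/
lemma indepFun_sum_sum_increments (hL : ∀ j, IsAdditiveProcess P (L j))
    (hLi : iIndepFun (fun j ω => (fun t => L j t ω : ℝ → ℝ)) P) {n : ℕ} {a b : Fin n → ℝ}
    (ha : ∀ i, 0 ≤ a i) (hab : ∀ i, a i ≤ b i) :
    IndepFun (fun ω => ∑ i : Fin n, L i (a i) ω) (fun ω => ∑ i : Fin n, (L i (b i) ω - L i (a i) ω)) P := by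
  set Y : Fin n → Fin 2 → Ω → ℝ := fun i k ω =>
    L i (![0, a i, b i] k.succ) ω - L i (![0, a i, b i] k.castSucc) ω with hY
  have mY : ∀ i k, Measurable (Y i k) := fun i k =>
    ((hL i).measurable _).sub ((hL i).measurable _)
  have hYi : iIndepFun (fun (p : Fin n × Fin 2) ω => Y p.1 p.2 ω) P :=
    iIndepFun_uncurry' mY
      ((hLi.precomp (g := fun i : Fin n => (i : ℕ)) Fin.val_injective).comp
        (fun i (l : ℝ → ℝ) (k : Fin 2) =>
          l (![0, a i, b i] k.succ) - l (![0, a i, b i] k.castSucc))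
        fun i => measurable_pi_lambda _ fun k =>
          (measurable_pi_apply _).sub (measurable_pi_apply _))
      fun i => (hL i).iIndepFun_increments (ha i) (hab i)
  have hd : Disjoint ((Finset.univ : Finset (Fin n)) ×ˢ ({0} : Finset (Fin 2)))
      ((Finset.univ : Finset (Fin n)) ×ˢ ({1} : Finset (Fin 2))) := by
    rw [Finset.disjoint_product]
    right
    decide
  have h1 := (hYi.indepFun_finset _ _ hd fun p => mY p.1 p.2).comp
    (φ := fun f => ∑ q, f q) (ψ := fun f => ∑ q, f q) (by fun_prop) (by fun_prop)
  refine h1.congr ?_ ?_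
  · filter_upwards [ae_all_iff.2 fun i : Fin n => (hL i).zero] with ω hω
    simp only [Function.comp_apply]
    rw [Finset.sum_coe_sort ((Finset.univ : Finset (Fin n)) ×ˢ ({0} : Finset (Fin 2)))
      (fun q => Y q.1 q.2 ω), Finset.sum_product]
    simp [hY, fun i : Fin n => hω i 0 le_rfl]
  · refine ae_of_all _ fun ω => ?_
    simp only [Function.comp_apply]
    rw [Finset.sum_coe_sort ((Finset.univ : Finset (Fin n)) ×ˢ ({1} : Finset (Fin 2)))
      (fun q => Y q.1 q.2 ω), Finset.sum_product]
    simp [hY]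

variable [IsProbabilityMeasure P]

lemma integral_exp_sum_increments (hν : IsJumpIntensity ν)
    (hL : ∀ j, IsJumpAdditiveProcess P ν (L j))
    (hLi : iIndepFun (fun j ω => (fun t => L j t ω : ℝ → ℝ)) P) (x : ℝ) {n : ℕ} {a b : Fin n → ℝ}
    (ha : ∀ i, 0 ≤ a i) (hab : ∀ i, a i ≤ b i) :
    ∫ ω, Complex.exp (Complex.I * x * ((∑ i : Fin n, (L i (b i) ω - L i (a i) ω) : ℝ) : ℂ)) ∂P
      = Complex.exp (∑ i, jumpExponent ν x (a i) (b i)) := by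
  have hi : iIndepFun (fun (i : Fin n) ω =>
      Complex.exp (Complex.I * x * ((L i (b i) ω - L i (a i) ω : ℝ) : ℂ))) P :=
    (hLi.precomp (g := fun i : Fin n => (i : ℕ)) Fin.val_injective).comp
      (fun i (l : ℝ → ℝ) => Complex.exp (Complex.I * x * ((l (b i) - l (a i) : ℝ) : ℂ)))
      fun i => by fun_prop
  have h1 := hi.integral_fun_prod_eq_prod_integral fun i => by
    have := (hL i).measurable
    fun_prop
  rw [Complex.exp_sum, ← Finset.prod_congr rfl fun (i : Fin n) _ =>
    (hL i).integral_exp_increment hν x (ha i) (hab i), ← h1]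
  refine integral_congr_ae (ae_of_all _ fun ω => ?_)
  simp only [Complex.ofReal_sum, Finset.mul_sum, Complex.exp_sum]

lemma integral_exp_mul_indicator (hν : IsJumpIntensity ν)
    (hL : ∀ j, IsJumpAdditiveProcess P ν (L j))
    (hLi : iIndepFun (fun j ω => (fun t => L j t ω : ℝ → ℝ)) P) (x : ℝ) {A : Set ℝ}
    (hA : MeasurableSet A) {n : ℕ} {a b : Fin n → ℝ}
    (ha : ∀ i, 0 ≤ a i) (hab : ∀ i, a i ≤ b i) :
    ∫ ω, Complex.exp (Complex.I * x * ((∑ i : Fin n, (L i (b i) ω - L i (a i) ω) : ℝ) : ℂ))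
        * ((A.indicator 1 (∑ i : Fin n, L i (a i) ω) : ℝ) : ℂ) ∂P
      = Complex.exp (∑ i, jumpExponent ν x (a i) (b i))
        * (P.real {ω | ∑ i : Fin n, L i (a i) ω ∈ A} : ℂ) := by
  have mL : ∀ (i : ℕ) u, Measurable (L i u) := fun i => (hL i).measurable
  have hi := indepFun_sum_sum_increments (fun j => (hL j).additive) hLi ha hab
  have m1 : Measurable fun y : ℝ => Complex.exp (Complex.I * x * (y : ℂ)) := by fun_prop
  have m2 : Measurable fun y : ℝ => ((A.indicator 1 y : ℝ) : ℂ) :=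
    Complex.measurable_ofReal.comp (measurable_one.indicator hA)
  have mS : Measurable fun ω => ∑ i : Fin n, L i (a i) ω :=
    Finset.measurable_sum _ fun i _ => mL i _
  have mR : Measurable fun ω => ∑ i : Fin n, (L i (b i) ω - L i (a i) ω) :=
    Finset.measurable_sum _ fun i _ => (mL i _).sub (mL i _)
  have h1 := (hi.symm.comp m1 m2).integral_fun_mul_eq_mul_integral
    (m1.comp mR).aestronglyMeasurable (m2.comp mS).aestronglyMeasurable
  simp only [Function.comp_apply] at h1
  rw [h1, integral_exp_sum_increments hν hL hLi x ha hab, integral_complex_ofReal]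
  congr 2
  exact integral_indicator_one (mS hA)

/-- All the processes share `ν`, so the characteristic function of the sum is the exponential of a
symmetric function of the times. -/
lemma map_sum_perm (hL : ∀ j, IsJumpAdditiveProcess P ν (L j))
    (hLi : iIndepFun (fun j ω => (fun t => L j t ω : ℝ → ℝ)) P) {n : ℕ} {a : Fin n → ℝ}
    (ha : ∀ i, 0 ≤ a i) (σ : Equiv.Perm (Fin n)) :
    P.map (fun ω => ∑ i : Fin n, L i ((a ∘ σ) i) ω) = P.map (fun ω => ∑ i : Fin n, L i (a i) ω) := by
  have mL : ∀ (i : ℕ) u, Measurable (L i u) := fun i => (hL i).measurable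
  have key : ∀ c : Fin n → ℝ, (∀ i, 0 ≤ c i) → ∀ y : ℝ,
      charFun (P.map (fun ω => ∑ i : Fin n, L i (c i) ω)) y
        = Complex.exp (∑ i, jumpExponent ν y 0 (c i)) := fun c hc y => by
    have mS : Measurable fun ω => ∑ i : Fin n, L i (c i) ω :=
      Finset.measurable_sum _ fun i _ => mL i _
    have hi : iIndepFun (fun (i : Fin n) ω => Complex.exp (Complex.I * y * (L i (c i) ω : ℂ))) P :=
      (hLi.precomp (g := fun i : Fin n => (i : ℕ)) Fin.val_injective).comp
        (fun i (l : ℝ → ℝ) => Complex.exp (Complex.I * y * (l (c i) : ℂ))) fun i => by fun_prop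
    have h1 := hi.integral_fun_prod_eq_prod_integral fun i => by
      have := (hL i).measurable
      fun_prop
    rw [Complex.exp_sum, ← Finset.prod_congr rfl fun (i : Fin n) _ =>
      (hL i).charFun_eq (c i) (hc i) y, ← h1,
      charFun_apply_real, integral_map mS.aemeasurable (by fun_prop)]
    refine integral_congr_ae (ae_of_all _ fun ω => ?_)
    simp only
    rw [← Complex.exp_sum, ← Finset.mul_sum, Complex.ofReal_sum]
    ring_nf
  have mS : ∀ c : Fin n → ℝ, Measurable fun ω => ∑ i : Fin n, L i (c i) ω := fun c =>
    Finset.measurable_sum _ fun i _ => mL i _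
  have := Measure.isProbabilityMeasure_map (μ := P) (mS (a ∘ σ)).aemeasurable
  have := Measure.isProbabilityMeasure_map (μ := P) (mS a).aemeasurable
  refine Measure.ext_of_charFun (funext fun y => ?_)
  have e : ∑ i, jumpExponent ν y 0 ((a ∘ σ) i) = ∑ i, jumpExponent ν y 0 (a i) :=
    Equiv.sum_comp σ fun i => jumpExponent ν y 0 (a i)
  exact (key (a ∘ σ) (fun i => ha _) y).trans (e ▸ (key a ha y).symm)

lemma measureReal_sum_perm (hL : ∀ j, IsJumpAdditiveProcess P ν (L j))
    (hLi : iIndepFun (fun j ω => (fun t => L j t ω : ℝ → ℝ)) P) {A : Set ℝ}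
    (hA : MeasurableSet A) {n : ℕ} {a : Fin n → ℝ}
    (ha : ∀ i, 0 ≤ a i) (σ : Equiv.Perm (Fin n)) :
    P.real {ω | ∑ i : Fin n, L i ((a ∘ σ) i) ω ∈ A} = P.real {ω | ∑ i : Fin n, L i (a i) ω ∈ A} := by
  have mS : ∀ c : Fin n → ℝ, Measurable fun ω => ∑ i : Fin n, L i (c i) ω := fun c =>
    Finset.measurable_sum _ fun i _ => (hL i).measurable _
  have h1 := congrArg (fun μ => μ.real A) (map_sum_perm hL hLi ha σ)
  simp only [map_measureReal_apply (mS _) hA] at h1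
  exact h1

end Sums

/-! ### Freezing lemma for independent random variables -/

section Freezing

variable {𝒴 𝒵 E : Type*} [MeasurableSpace 𝒴] [MeasurableSpace 𝒵] [NormedAddCommGroup E]
  [NormedSpace ℝ E] [IsProbabilityMeasure P] {Y : Ω → 𝒴} {Z : Ω → 𝒵} {Φ : 𝒴 × 𝒵 → E} {C : ℝ}

/-- Fubini for the joint law of `(Y, Z)`, which is a product. The set `B` allows restriction to
`N(1) = n` and gives the defining identity of the conditional expectation. -/
lemma setIntegral_eq_setIntegral_integral_of_indepFun (hY : Measurable Y) (hZ : Measurable Z)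
    (hYZ : IndepFun Y Z P) (hΦ : StronglyMeasurable Φ) (hC : ∀ p, ‖Φ p‖ ≤ C) {B : Set 𝒴}
    (hB : MeasurableSet B) :
    ∫ ω in Y ⁻¹' B, Φ (Y ω, Z ω) ∂P = ∫ ω in Y ⁻¹' B, ∫ z, Φ (Y ω, z) ∂(P.map Z) ∂P := by
  have := Measure.isProbabilityMeasure_map (μ := P) hY.aemeasurable
  have := Measure.isProbabilityMeasure_map (μ := P) hZ.aemeasurable
  have hmap := (indepFun_iff_map_prod_eq_prod_map_map hY.aemeasurable hZ.aemeasurable).1 hYZ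
  have h1 := setIntegral_map (hB.prod (MeasurableSet.univ (α := 𝒵))) hΦ.aestronglyMeasurable
    (hY.prodMk hZ).aemeasurable (μ := P) (f := Φ)
  have h2 := setIntegral_map hB
    hΦ.integral_prod_right'.aestronglyMeasurable hY.aemeasurable (μ := P)
    (f := fun y => ∫ z, Φ (y, z) ∂(P.map Z))
  rw [← h2]
  have e : (fun ω => (Y ω, Z ω)) ⁻¹' (B ×ˢ univ) = Y ⁻¹' B := by
    ext ω
    simp
  rw [e] at h1
  rw [← h1, hmap, setIntegral_prod _
    (Integrable.of_bound hΦ.aestronglyMeasurable C (ae_of_all _ hC)).integrableOn]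
  simp only [setIntegral_univ]

lemma integrable_integral_of_bound (hY : Measurable Y) (hZ : Measurable Z)
    (hΦ : StronglyMeasurable Φ) (hC : ∀ p, ‖Φ p‖ ≤ C) :
    Integrable (fun ω => ∫ z, Φ (Y ω, z) ∂(P.map Z)) P := by
  have := Measure.isProbabilityMeasure_map (μ := P) hZ.aemeasurable
  refine Integrable.of_bound (hΦ.integral_prod_right'.comp_measurable hY).aestronglyMeasurable C
    (ae_of_all _ fun ω => ?_)
  refine (norm_integral_le_of_norm_le_const (ae_of_all _ fun z => hC (Y ω, z))).trans ?_
  simp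

lemma condExp_ae_eq_integral_of_indepFun [CompleteSpace E] (hY : Measurable Y) (hZ : Measurable Z)
    (hYZ : IndepFun Y Z P) (hΦ : StronglyMeasurable Φ) (hC : ∀ p, ‖Φ p‖ ≤ C) :
    P[fun ω => Φ (Y ω, Z ω) | MeasurableSpace.comap Y inferInstance]
      =ᵐ[P] fun ω => ∫ z, Φ (Y ω, z) ∂(P.map Z) := by
  have := Measure.isProbabilityMeasure_map (μ := P) hZ.aemeasurable
  refine (ae_eq_condExp_of_forall_setIntegral_eq hY.comap_le
    (Integrable.of_bound (hΦ.comp_measurable (hY.prodMk hZ)).aestronglyMeasurable C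
      (ae_of_all _ fun ω => hC _))
    (fun _ _ _ => (integrable_integral_of_bound hY hZ hΦ hC).integrableOn) ?_ ?_).symm
  · rintro _ ⟨B, hB, rfl⟩ _
    exact (setIntegral_eq_setIntegral_integral_of_indepFun hY hZ hYZ hΦ hC hB).symm
  · exact (hΦ.integral_prod_right'.comp_measurable (comap_measurable Y)).aestronglyMeasurable

end Freezing

/-! ### The cluster functional on path space -/

/-- `∑_{j < n} l_j(t - τ_j)` for deterministic paths, jointly measurable in all arguments. -/
noncomputable def pathSum (t : ℝ) (p : (ℕ × (ℕ → ℝ)) × (ℕ → ℝ → ℝ)) : ℝ :=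
  ∑ j ∈ Finset.range p.1.1, rightEval (t - p.1.2 j) (p.2 j)

/-- The integrand `e^{ix M(t,t+s]} 1{M(t) ∈ A}` as a functional of points and paths. -/
noncomputable def pathFunctional (x t s : ℝ) (A : Set ℝ) (p : (ℕ × (ℕ → ℝ)) × (ℕ → ℝ → ℝ)) : ℂ :=
  Complex.exp (Complex.I * x * ((pathSum (t + s) p - pathSum t p : ℝ) : ℂ))
    * ((A.indicator 1 (pathSum t p) : ℝ) : ℂ)

lemma measurable_pathSum (t : ℝ) : Measurable (pathSum t) := by
  have h : ∀ j, Measurable fun p : (ℕ × (ℕ → ℝ)) × (ℕ → ℝ → ℝ) =>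
      rightEval (t - p.1.2 j) (p.2 j) := fun j => by
    refine measurable_rightEval (measurable_const.sub ?_) ?_
    · exact (measurable_pi_apply j).comp (measurable_snd.comp measurable_fst)
    · exact (measurable_pi_apply j).comp measurable_snd
  exact measurable_apply_nat (N := fun p : (ℕ × (ℕ → ℝ)) × (ℕ → ℝ → ℝ) => p.1.1)
    (measurable_fst.comp measurable_fst)
    (F := fun n p => ∑ j ∈ Finset.range n, rightEval (t - p.1.2 j) (p.2 j))
    fun n => Finset.measurable_sum _ fun j _ => h j

lemma measurable_indicator_pathSum (t : ℝ) {A : Set ℝ} (hA : MeasurableSet A) :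
    Measurable fun p => (A.indicator 1 (pathSum t p) : ℝ) :=
  (measurable_one.indicator hA).comp (measurable_pathSum t)

lemma measurable_pathFunctional (x t s : ℝ) {A : Set ℝ} (hA : MeasurableSet A) :
    Measurable (pathFunctional x t s A) := by
  have h1 := measurable_indicator_pathSum t hA
  have h2 := measurable_pathSum t
  have h3 := measurable_pathSum (t + s)
  unfold pathFunctional
  fun_prop

lemma norm_indicator_one_le (A : Set ℝ) (y : ℝ) : ‖(A.indicator 1 y : ℝ)‖ ≤ 1 := by
  by_cases h : y ∈ A <;> simp [h]

lemma norm_pathFunctional_le (x t s : ℝ) (A : Set ℝ) (p : (ℕ × (ℕ → ℝ)) × (ℕ → ℝ → ℝ)) :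
    ‖pathFunctional x t s A p‖ ≤ 1 := by
  have e : Complex.I * x * ((pathSum (t + s) p - pathSum t p : ℝ) : ℂ)
      = ((x * (pathSum (t + s) p - pathSum t p) : ℝ) : ℂ) * Complex.I := by
    push_cast
    ring
  rw [pathFunctional, norm_mul, e, Complex.norm_exp_ofReal_mul_I, one_mul, Complex.norm_real]
  exact norm_indicator_one_le _ _

lemma pathSum_congr (t : ℝ) {n : ℕ} {τ τ' : ℕ → ℝ} (h : ∀ j < n, τ j = τ' j) (l : ℕ → ℝ → ℝ) :
    pathSum t ((n, τ), l) = pathSum t ((n, τ'), l) :=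
  Finset.sum_congr rfl fun j hj => by
    simp only [Finset.mem_range] at hj
    simp only [h j hj]

lemma pathFunctional_congr (x t s : ℝ) (A : Set ℝ) {n : ℕ} {τ τ' : ℕ → ℝ}
    (h : ∀ j < n, τ j = τ' j) (l : ℕ → ℝ → ℝ) :
    pathFunctional x t s A ((n, τ), l) = pathFunctional x t s A ((n, τ'), l) := by
  simp only [pathFunctional, pathSum_congr _ h]

section Clusters

variable {ν : Measure (ℝ × ℝ)} {L : ℕ → ℝ → Ω → ℝ}

lemma measurable_paths (hL : ∀ j, IsAdditiveProcess P (L j)) :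
    Measurable fun ω j t => L j t ω :=
  measurable_pi_lambda _ fun j => measurable_pi_lambda _ fun t => (hL j).measurable t

lemma ae_pathSum_eq (hL : ∀ j, IsAdditiveProcess P (L j)) :
    ∀ᵐ ω ∂P, ∀ (t : ℝ) (n : ℕ) (τ : ℕ → ℝ), pathSum t ((n, τ), fun j u => L j u ω)
      = ∑ j ∈ Finset.range n, L j (t - τ j) ω := by
  filter_upwards [ae_all_iff.2 fun j => (hL j).ae_rightEval_eq] with ω hω t n τ
  exact Finset.sum_congr rfl fun j _ => hω j _

lemma integral_indicator_pathSum (hL : ∀ j, IsAdditiveProcess P (L j)) (t : ℝ) {A : Set ℝ}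
    (hA : MeasurableSet A) (n : ℕ) (τ : ℕ → ℝ) :
    ∫ l, (A.indicator 1 (pathSum t ((n, τ), l)) : ℝ) ∂(P.map fun ω j u => L j u ω)
      = P.real {ω | ∑ j ∈ Finset.range n, L j (t - τ j) ω ∈ A} := by
  have mI : Measurable fun l => (A.indicator 1 (pathSum t ((n, τ), l)) : ℝ) :=
    (measurable_indicator_pathSum t hA).comp measurable_prodMk_left
  rw [integral_map (measurable_paths hL).aemeasurable mI.aestronglyMeasurable]
  have mS : Measurable fun ω => ∑ j ∈ Finset.range n, L j (t - τ j) ω :=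
    Finset.measurable_sum _ fun j _ => (hL j).measurable _
  refine (integral_congr_ae ?_).trans (integral_indicator_one (mS hA))
  filter_upwards [ae_pathSum_eq hL] with ω hω
  rw [hω]
  rfl

variable [IsProbabilityMeasure P]

lemma integral_pathFunctional (hν : IsJumpIntensity ν) (hL : ∀ j, IsJumpAdditiveProcess P ν (L j))
    (hLi : iIndepFun (fun j ω => (fun t => L j t ω : ℝ → ℝ)) P) (x t : ℝ) {s : ℝ} (hs : 0 ≤ s)
    {A : Set ℝ} (hA : MeasurableSet A) (n : ℕ) (τ : ℕ → ℝ) (hτ : ∀ j < n, τ j ≤ t) :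
    ∫ l, pathFunctional x t s A ((n, τ), l) ∂(P.map fun ω j u => L j u ω)
      = Complex.exp (∑ j ∈ Finset.range n, jumpExponent ν x (t - τ j) (t + s - τ j))
        * (P.real {ω | ∑ j ∈ Finset.range n, L j (t - τ j) ω ∈ A} : ℂ) := by
  have hL' := fun j => (hL j).additive
  have mI : Measurable fun l => pathFunctional x t s A ((n, τ), l) :=
    (measurable_pathFunctional x t s hA).comp measurable_prodMk_left
  rw [integral_map (measurable_paths hL').aemeasurable mI.aestronglyMeasurable]
  have key := integral_exp_mul_indicator hν hL hLi x hA (n := n)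
    (a := fun i => t - τ i) (b := fun i => t + s - τ i)
    (fun i => sub_nonneg.2 (hτ i i.2)) (fun i => by linarith)
  simp only [Finset.sum_range]
  rw [← key]
  refine integral_congr_ae ?_
  filter_upwards [ae_pathSum_eq hL'] with ω hω
  rw [pathFunctional, hω, hω]
  simp only [Finset.sum_range, Finset.sum_sub_distrib]

lemma integral_pathFunctional_perm (hν : IsJumpIntensity ν)
    (hL : ∀ j, IsJumpAdditiveProcess P ν (L j))
    (hLi : iIndepFun (fun j ω => (fun t => L j t ω : ℝ → ℝ)) P) (x t : ℝ) {s : ℝ} (hs : 0 ≤ s)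
    {A : Set ℝ} (hA : MeasurableSet A) {n : ℕ} {τ τ' : ℕ → ℝ} (hτ : ∀ j < n, τ j ≤ t)
    (σ : Equiv.Perm (Fin n)) (hσ : ∀ i : Fin n, τ' i = τ (σ i)) :
    ∫ l, pathFunctional x t s A ((n, τ'), l) ∂(P.map fun ω j u => L j u ω)
      = ∫ l, pathFunctional x t s A ((n, τ), l) ∂(P.map fun ω j u => L j u ω) := by
  have hτ' : ∀ j < n, τ' j ≤ t := fun j hj => by
    rw [hσ ⟨j, hj⟩]
    exact hτ _ (σ _).2
  rw [integral_pathFunctional hν hL hLi x t hs hA n τ hτ,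
    integral_pathFunctional hν hL hLi x t hs hA n τ' hτ']
  -- The probability is invariant in law, the exponent as a finite sum.
  have h1 := measureReal_sum_perm hL hLi hA (a := fun i : Fin n => t - τ i)
    (fun i => sub_nonneg.2 (hτ i i.2)) σ
  have h2 := Equiv.sum_comp σ fun i : Fin n => jumpExponent ν x (t - τ i) (t + s - τ i)
  simp only [Finset.sum_range, hσ]
  simp only [Function.comp_apply] at h1
  rw [h1, h2]

end Clusters

/-! ### Points against marks -/

section Transfer

variable {Λ : Measure ℝ} {ν : Measure (ℝ × ℝ)} {T : ℕ → Ω → ℝ≥0∞}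
  {L : ℕ → ℝ → Ω → ℝ} {V : ℕ → Ω → ℝ}

lemma measurable_count_prodMk (hT : ∀ j, Measurable (T j)) {W : ℕ → Ω → ℝ}
    (hW : ∀ j, Measurable (W j)) : Measurable fun ω => (count T 1 ω, fun j => W j ω) :=
  (measurable_count hT 1).prodMk (measurable_pi_lambda _ hW)

/-- `N(1)` is a measurable functional of the sequence of points, namely `count` on sequence space.
-/
lemma IsClusterModel.indepFun_points (hM : IsClusterModel P Λ ν T L) :
    IndepFun (fun ω => (count T 1 ω, fun j => (T j ω).toReal)) (fun ω j t => L j t ω) P := by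
  have m1 : Measurable (count (fun j (τ : ℕ → ℝ≥0∞) => τ j) 1) :=
    measurable_count measurable_pi_apply 1
  have m2 : Measurable fun τ : ℕ → ℝ≥0∞ => (count (fun j (τ : ℕ → ℝ≥0∞) => τ j) 1 τ,
      fun j => (τ j).toReal) :=
    m1.prodMk (measurable_pi_lambda _ fun j => (measurable_pi_apply j).ennreal_toReal)
  exact hM.indep.comp m2 measurable_id

lemma IsClusterModel.ae_pathSum_points_eq (hM : IsClusterModel P Λ ν T L) :
    ∀ᵐ ω ∂P, ∀ t, pathSum t ((count T 1 ω, fun j => (T j ω).toReal), fun j u => L j u ω)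
      = clusterSum T L t ω := by
  filter_upwards [ae_pathSum_eq fun j => (hM.cluster j).additive] with ω hω t
  exact hω t _ _

lemma IsClusterModel.ae_pathSum_marks_eq (hM : IsClusterModel P Λ ν T L) (V : ℕ → Ω → ℝ) :
    ∀ᵐ ω ∂P, ∀ t, pathSum t ((count T 1 ω, fun j => V j ω), fun j u => L j u ω)
      = shiftedSum T L V t ω := by
  filter_upwards [ae_pathSum_eq fun j => (hM.cluster j).additive] with ω hω t
  exact hω t _ _

variable [IsProbabilityMeasure P]

/-- On each `N(1) = n` the paths are integrated out first: the integrand is not symmetric pathwise,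
only its mean over the paths is. The order statistics property then applies. -/
lemma IsClusterModel.integral_points_eq_integral_marks (hM : IsClusterModel P Λ ν T L)
    (hΛ : Λ (Icc 0 1) ≠ 0) (hV : IsMarkSequence P Λ T V)
    (hVL : IndepFun (fun ω => (count T 1 ω, fun j => V j ω)) (fun ω j t => L j t ω) P)
    (x : ℝ) {t s : ℝ} (ht : 1 ≤ t) (hs : 0 ≤ s) {A : Set ℝ} (hA : MeasurableSet A) :
    ∫ ω, pathFunctional x t s A
        ((count T 1 ω, fun j => (T j ω).toReal), fun j u => L j u ω) ∂P
      = ∫ ω, pathFunctional x t s A ((count T 1 ω, fun j => V j ω), fun j u => L j u ω) ∂P := by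
  have mT := hM.points.measurable
  have mZ := measurable_paths fun j => (hM.cluster j).additive
  have mYT := measurable_count_prodMk mT fun j => (mT j).ennreal_toReal
  have mYV := measurable_count_prodMk mT hV.measurable
  have mΦ := measurable_pathFunctional x t s hA
  have bΦ := norm_pathFunctional_le x t s A
  have := Measure.isProbabilityMeasure_map (μ := P) mZ.aemeasurable
  refine integral_eq_of_forall_setIntegral_fiber_eq (measurable_count mT 1)
    (Integrable.of_bound (mΦ.comp (mYT.prodMk mZ)).aestronglyMeasurable 1
      (ae_of_all _ fun _ => bΦ _))
    (Integrable.of_bound (mΦ.comp (mYV.prodMk mZ)).aestronglyMeasurable 1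
      (ae_of_all _ fun _ => bΦ _)) fun n => ?_
  have hB : MeasurableSet (({n} : Set ℕ) ×ˢ (univ : Set (ℕ → ℝ))) :=
    (measurableSet_singleton n).prod .univ
  have hpre : ∀ W : ℕ → Ω → ℝ, (fun ω => (count T 1 ω, fun j => W j ω)) ⁻¹'
      (({n} : Set ℕ) ×ˢ (univ : Set (ℕ → ℝ))) = count T 1 ⁻¹' {n} := fun W => by
    ext ω
    simp
  have f1 := setIntegral_eq_setIntegral_integral_of_indepFun mYT mZ hM.indepFun_points
    mΦ.stronglyMeasurable bΦ hB
  have f2 := setIntegral_eq_setIntegral_integral_of_indepFun mYV mZ hVL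
    mΦ.stronglyMeasurable bΦ hB
  rw [hpre fun j ω => (T j ω).toReal] at f1
  rw [hpre] at f2
  rw [f1, f2]
  -- Padding by `0` turns `n` times into a sequence; entries from `n` on are never read by
  -- `pathFunctional`.
  set ext : (Fin n → ℝ) → ℕ → ℝ := fun v j => if h : j < n then v ⟨j, h⟩ else 0 with hext
  have mext : Measurable ext := by
    refine measurable_pi_lambda _ fun j => ?_
    by_cases h : j < n
    · simpa [hext, h] using measurable_pi_apply _
    · simp [hext, h]
  set g : (Fin n → ℝ) → ℂ := fun v =>
    ∫ l, pathFunctional x t s A ((n, ext v), l) ∂(P.map fun ω j u => L j u ω) with hg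
  have mg : StronglyMeasurable g :=
    mΦ.stronglyMeasurable.integral_prod_right'.comp_measurable (measurable_const.prodMk mext)
  have hgW : ∀ W : ℕ → Ω → ℝ, ∫ ω in count T 1 ⁻¹' {n}, ∫ l, pathFunctional x t s A
      ((count T 1 ω, fun j => W j ω), l) ∂(P.map fun ω j u => L j u ω) ∂P
      = ∫ ω in count T 1 ⁻¹' {n}, g (fun k => W k ω) ∂P := fun W => by
    refine setIntegral_congr_fun (measurable_count mT 1 (measurableSet_singleton n)) fun ω hω => ?_
    rw [mem_preimage, mem_singleton_iff] at hω
    simp only [hg, hω]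
    exact integral_congr_ae (ae_of_all _ fun l =>
      pathFunctional_congr x t s A (fun j hj => by simp [hext, hj]) l)
  rw [hgW fun j ω => (T j ω).toReal, hgW V]
  refine setIntegral_points_eq_setIntegral_marks hM.points hΛ hV mg fun v hv σ => ?_
  exact integral_pathFunctional_perm hM.intensity hM.cluster hM.cluster_indep x t hs hA
    (fun j hj => by simpa [hext, hj] using (hv _).trans ht) σ (fun i => by simp [hext])

/-- With `x = 0` and `s = 0` the path functional is the bare indicator of `A`. -/
lemma IsClusterModel.measureReal_points_eq_marks (hM : IsClusterModel P Λ ν T L)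
    (hΛ : Λ (Icc 0 1) ≠ 0) (hV : IsMarkSequence P Λ T V)
    (hVL : IndepFun (fun ω => (count T 1 ω, fun j => V j ω)) (fun ω j t => L j t ω) P)
    {t : ℝ} (ht : 1 ≤ t) {A : Set ℝ} (hA : MeasurableSet A) :
    P.real {ω | clusterSum T L t ω ∈ A} = P.real {ω | shiftedSum T L V t ω ∈ A} := by
  have mT := hM.points.measurable
  have mZ := measurable_paths fun j => (hM.cluster j).additive
  have key := hM.integral_points_eq_integral_marks hΛ hV hVL 0 ht le_rfl hA
  have h : ∀ {W : ℕ → Ω → ℝ} {S : Ω → ℝ}, (∀ j, Measurable (W j)) →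
      (∀ᵐ ω ∂P, pathSum t ((count T 1 ω, fun j => W j ω), fun j u => L j u ω) = S ω) →
      ∫ ω, pathFunctional 0 t 0 A ((count T 1 ω, fun j => W j ω), fun j u => L j u ω) ∂P
        = (P.real {ω | S ω ∈ A} : ℂ) := fun {W S} mW hS => by
    have mS : Measurable fun ω =>
        pathSum t ((count T 1 ω, fun j => W j ω), fun j u => L j u ω) :=
      (measurable_pathSum t).comp ((measurable_count_prodMk mT mW).prodMk mZ)
    have e : P.real {ω | S ω ∈ A} = P.real ((fun ω =>
        pathSum t ((count T 1 ω, fun j => W j ω), fun j u => L j u ω)) ⁻¹' A) := by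
      refine measureReal_congr (eventuallyEq_set.2 ?_)
      filter_upwards [hS] with ω hω
      simp [hω]
    rw [e, ← integral_indicator_one (mS hA), ← integral_complex_ofReal]
    refine integral_congr_ae (ae_of_all _ fun ω => ?_)
    have e2 : ((fun ω => pathSum t ((count T 1 ω, fun j => W j ω), fun j u => L j u ω)) ⁻¹'
        A).indicator (1 : Ω → ℝ) ω
        = A.indicator 1 (pathSum t ((count T 1 ω, fun j => W j ω), fun j u => L j u ω)) := rfl
    simp only [e2, pathFunctional, Complex.ofReal_zero, mul_zero, zero_mul, Complex.exp_zero,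
      one_mul]
  rw [h (fun j => (mT j).ennreal_toReal) (hM.ae_pathSum_points_eq.mono fun ω hω => hω t),
    h hV.measurable ((hM.ae_pathSum_marks_eq V).mono fun ω hω => hω t)] at key
  exact_mod_cast key

lemma IsClusterModel.numeratorVar_ae_eq (hM : IsClusterModel P Λ ν T L)
    (hV : IsMarkSequence P Λ T V)
    (hVL : IndepFun (fun ω => (count T 1 ω, fun j => V j ω)) (fun ω j t => L j t ω) P)
    (x : ℝ) {t s : ℝ} (ht : 1 ≤ t) (hs : 0 ≤ s) {A : Set ℝ} (hA : MeasurableSet A) :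
    numeratorVar P ν T L V t s x A =ᵐ[P] fun ω => ∫ l, pathFunctional x t s A
      ((count T 1 ω, fun j => V j ω), l) ∂(P.map fun ω j u => L j u ω) := by
  have hL := fun j => (hM.cluster j).additive
  have mZ := measurable_paths hL
  have mY := measurable_count_prodMk hM.points.measurable hV.measurable
  have h1 := condExp_ae_eq_integral_of_indepFun mY mZ hVL
    (measurable_indicator_pathSum t hA).stronglyMeasurable (fun p => norm_indicator_one_le A _)
  have h2 : ({ω' | shiftedSum T L V t ω' ∈ A}.indicator fun _ => (1 : ℝ)) =ᵐ[P] fun ω =>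
      (A.indicator 1 (pathSum t ((count T 1 ω, fun j => V j ω), fun j u => L j u ω)) : ℝ) := by
    filter_upwards [hM.ae_pathSum_marks_eq V] with ω hω
    rw [hω]
    rfl
  have h3 := (condExp_congr_ae (m := sigmaNV T V) h2).trans h1
  filter_upwards [h3, hV.ae_mem_Ioc hM.points] with ω hω hω1
  rw [numeratorVar, hω, integral_indicator_pathSum hL t hA,
    integral_pathFunctional hM.intensity hM.cluster hM.cluster_indep x t hs hA _ _
      fun j _ => (hω1 j).2.trans ht]

end Transfer

/-! ### Independence of the marks -/

section MutualIndep

variable {T : ℕ → Ω → ℝ≥0∞} {L : ℕ → ℝ → Ω → ℝ} {V : ℕ → Ω → ℝ}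

lemma indepFun_count_marks
    (hindep : iIndep
      ![MeasurableSpace.comap (fun ω j => V j ω) inferInstance,
        MeasurableSpace.comap (fun ω j t => L j t ω) inferInstance,
        MeasurableSpace.comap (fun ω t => count T t ω) inferInstance] P) :
    IndepFun (count T 1) (fun ω j => V j ω) P := by
  have h : IndepFun (fun ω t => count T t ω) (fun ω j => V j ω) P :=
    (IndepFun_iff_Indep _ _ _).2 (hindep.indep (i := 2) (j := 0) (by decide))
  exact h.comp (measurable_pi_apply (1 : ℝ)) measurable_id

lemma indepFun_count_marks_paths (hT : ∀ j, Measurable (T j)) (hV : ∀ j, Measurable (V j))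
    (hL : ∀ j, IsAdditiveProcess P (L j))
    (hindep : iIndep
      ![MeasurableSpace.comap (fun ω j => V j ω) inferInstance,
        MeasurableSpace.comap (fun ω j t => L j t ω) inferInstance,
        MeasurableSpace.comap (fun ω t => count T t ω) inferInstance] P) :
    IndepFun (fun ω => (count T 1 ω, fun j => V j ω)) (fun ω j t => L j t ω) P := by
  have hle : ∀ i, ![MeasurableSpace.comap (fun ω j => V j ω) inferInstance,
      MeasurableSpace.comap (fun ω j t => L j t ω) inferInstance,
      MeasurableSpace.comap (fun ω t => count T t ω) inferInstance] i ≤ ‹MeasurableSpace Ω› := by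
    intro i
    fin_cases i
    · exact (measurable_pi_lambda _ hV).comap_le
    · exact (measurable_paths hL).comap_le
    · exact (measurable_pi_lambda _ fun t => measurable_count hT t).comap_le
  -- The σ-algebras of `N` and `(V_j)` are grouped against that of the paths.
  have h := indep_iSup_of_disjoint hle hindep (S := {2, 0}) (T := {1}) (by simp)
  rw [iSup_pair, iSup_singleton] at h
  rw [IndepFun_iff_Indep]
  refine indep_of_indep_of_le_left h (Measurable.comap_le ?_)
  refine @Measurable.prodMk _ _ _ _ _ (_) _ _ ?_ ?_
  · refine Measurable.mono ?_ (le_sup_left (a := MeasurableSpace.comap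
      (fun ω t => count T t ω) inferInstance)) le_rfl
    exact (measurable_pi_apply (1 : ℝ)).comp (comap_measurable fun ω t => count T t ω)
  · exact Measurable.mono (comap_measurable fun ω j => V j ω) le_sup_right le_rfl

end MutualIndep

/-! ### Conditioning on `M(t) ∈ A`, and the final quotient -/

lemma IsClusterModel.integral_cond [IsProbabilityMeasure P] {Λ : Measure ℝ} {ν : Measure (ℝ × ℝ)}
    {T : ℕ → Ω → ℝ≥0∞} {L : ℕ → ℝ → Ω → ℝ} (hM : IsClusterModel P Λ ν T L) (x t s : ℝ)
    {A : Set ℝ} (hA : MeasurableSet A) :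
    ∫ ω, Complex.exp (Complex.I * x * ((clusterSum T L (t + s) ω - clusterSum T L t ω : ℝ) : ℂ))
        ∂(ProbabilityTheory.cond P {ω | clusterSum T L t ω ∈ A})
      = (∫ ω, pathFunctional x t s A
          ((count T 1 ω, fun j => (T j ω).toReal), fun j u => L j u ω) ∂P)
        / (P.real {ω | clusterSum T L t ω ∈ A} : ℂ) := by
  have mT := hM.points.measurable
  have mS : Measurable fun ω =>
      pathSum t ((count T 1 ω, fun j => (T j ω).toReal), fun j u => L j u ω) :=
    (measurable_pathSum t).comp ((measurable_count_prodMk mT fun j => (mT j).ennreal_toReal).prodMk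
      (measurable_paths fun j => (hM.cluster j).additive))
  -- `clusterSum` evaluates paths at random times and is not assumed measurable; its event is
  -- replaced by an a.e. equal measurable one.
  have hS : {ω | clusterSum T L t ω ∈ A} =ᵐ[P] (fun ω =>
      pathSum t ((count T 1 ω, fun j => (T j ω).toReal), fun j u => L j u ω)) ⁻¹' A := by
    refine eventuallyEq_set.2 ?_
    filter_upwards [hM.ae_pathSum_points_eq] with ω hω
    simp [hω]
  rw [ProbabilityTheory.cond, integral_smul_measure, Measure.restrict_congr_set hS,
    ← integral_indicator (mS hA), ENNReal.toReal_inv, Complex.real_smul, Complex.ofReal_inv,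
    inv_mul_eq_div]
  congr 1
  refine integral_congr_ae ?_
  filter_upwards [hM.ae_pathSum_points_eq] with ω hω
  by_cases h : pathSum t ((count T 1 ω, fun j => (T j ω).toReal), fun j u => L j u ω) ∈ A
  · rw [indicator_of_mem (by exact h), pathFunctional, indicator_of_mem h, hω, hω]
    simp
  · rw [indicator_of_notMem (by exact h), pathFunctional, indicator_of_notMem h]
    simp

end PoissonCluster

theorem lemma2p2 {Ω : Type*} [MeasurableSpace Ω] (P : Measure Ω) [IsProbabilityMeasure P]
    (Λ : Measure ℝ) (ν : Measure (ℝ × ℝ))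
    (T : ℕ → Ω → ℝ≥0∞) (L : ℕ → ℝ → Ω → ℝ) (V : ℕ → Ω → ℝ)
    (hM : PoissonCluster.IsClusterModel P Λ ν T L)
    (hΛ : Λ (Icc 0 1) ≠ 0)
    (hVm : ∀ j, Measurable (V j))
    (hVindep : iIndepFun V P)
    (hVlaw : ∀ j, P.map (V j) = (Λ (Icc 0 1))⁻¹ • Λ.restrict (Icc 0 1))
    -- `(V_j)`, `(L_j)` and the process `N` are mutually independent
    (hindep : iIndep
      ![MeasurableSpace.comap (fun ω j => V j ω) inferInstance,
        MeasurableSpace.comap (fun ω j t => L j t ω) inferInstance,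
        MeasurableSpace.comap (fun ω t => PoissonCluster.count T t ω) inferInstance] P)
    (t s x : ℝ) (ht : 1 ≤ t) (hs : 0 < s) (A : Set ℝ) (hA : MeasurableSet A)
    (hpos : P {ω | PoissonCluster.clusterSum T L t ω ∈ A} ≠ 0) :
    P {ω | PoissonCluster.shiftedSum T L V t ω ∈ A} ≠ 0 ∧
    Integrable (PoissonCluster.numeratorVar P ν T L V t s x A) P ∧
    ∫ ω, Complex.exp (Complex.I * x *
        ((PoissonCluster.clusterSum T L (t + s) ω - PoissonCluster.clusterSum T L t ω : ℝ) : ℂ))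
        ∂(ProbabilityTheory.cond P {ω | PoissonCluster.clusterSum T L t ω ∈ A})
      = (∫ ω, PoissonCluster.numeratorVar P ν T L V t s x A ω ∂P)
        / (P.real {ω | PoissonCluster.shiftedSum T L V t ω ∈ A} : ℂ) := by
  have hN := hM.points
  have hL := fun j => (hM.cluster j).additive
  have hV : PoissonCluster.IsMarkSequence P Λ T V :=
    ⟨hVm, hVindep, hVlaw, PoissonCluster.indepFun_count_marks hindep⟩
  have hVL := PoissonCluster.indepFun_count_marks_paths hN.measurable hVm hL hindep
  have hprob := hM.measureReal_points_eq_marks hΛ hV hVL ht hA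
  have hnum := hM.numeratorVar_ae_eq hV hVL x ht hs.le hA
  have mY := PoissonCluster.measurable_count_prodMk hN.measurable hVm
  have mZ := PoissonCluster.measurable_paths hL
  have mΦ := (PoissonCluster.measurable_pathFunctional x t s hA).stronglyMeasurable
  have bΦ := PoissonCluster.norm_pathFunctional_le x t s A
  refine ⟨fun h0 => hpos ?_, ?_, ?_⟩
  · rw [← measureReal_eq_zero_iff] at h0 ⊢
    rw [hprob, h0]
  · exact (PoissonCluster.integrable_integral_of_bound mY mZ mΦ bΦ).congr hnum.symm
  · have h1 := PoissonCluster.setIntegral_eq_setIntegral_integral_of_indepFun mY mZ hVL mΦ bΦ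
      MeasurableSet.univ
    rw [preimage_univ, setIntegral_univ, setIntegral_univ] at h1
    rw [hM.integral_cond x t s hA, hM.integral_points_eq_integral_marks hΛ hV hVL x ht hs.le hA,
      integral_congr_ae hnum, h1, hprob]
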